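/- For $z\in\mathbb C\setminus(-\infty,0]$ let $\sqrt z$ be the principal square root, and for $x\neq y$ in $\mathbb R^3$ let $$G_0(x,y;z)=\frac{1}{4\pi}\,\frac{e^{i\sqrt z\,\|x-y\|}}{\|x-y\|}$$ be the Green's function of $-\Delta$ on $L^2(\mathbb R^3)$ ($\|\cdot\|$ is the Euclidean norm). Let $\omega=(\omega_j)_{j\in\mathbb Z^3}$ be any family of real numbers (for instance any realization of a family of random coupling constants), and let $\Lambda=\{j\in\mathbb Z^3:\omega_j\neq0\}$. Let $\Gamma(z,\omega)$ be the operator on $\ell^2(\Lambda)$, with domain $\{u\in\ell^2(\Lambda):\Gamma(z,\omega)u\in\ell^2(\Lambda)\}$, given by the matrix $$[\Gamma(z,\omega)]_{ij}=\Big(\frac1{\omega_j}-\frac{i\sqrt z}{4\pi}\Big)\delta_{ij}-G_0(i,j;z)(1-\delta_{ij}),\qquad i,j\in\Lambda .$$ The Green's function of the operator $H_\omega$, formally $-\Delta+\sum_{j\in\mathbb Z^3}\omega_j\,\delta(x-j)$, is $$G_\omega(x,y;z)=G_0(x,y;z)+\sum_{i,j\in\Lambda}G_0(x,i;z)\,[\Gamma(z,\omega)^{-1}]_{ij}\,G_0(j,y;z).$$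 Let $d(x)=\operatorname{dist}(x,\mathbb Z^3)$ and $C_0=\{x\in\mathbb R^3:|x_i|\le\frac12,\ i=1,2,3\}$. **Theorem (Combes–Thomas estimate).** For every $z\in\mathbb C$ with $\operatorname{Im}z>0$ there are finite constants $C=C_z>0$ and $\gamma=\gamma(z)>0$, depending only on $z$, such that for every $\omega$ the operator $\Gamma(z,\omega)$ has a bounded everywhere defined inverse on $\ell^2(\Lambda)$, the double series above converges absolutely for all $x,y\in\mathbb R^3\setminus\mathbb Z^3$, and the following hold. 1. For all $x,y\in\mathbb R^3\setminus\mathbb Z^3$ with $\|x-y\|\ge1$, $$|G_\omega(x,y;z)|\le\frac{C}{d(x)\,d(y)}\,e^{-\gamma\|x-y\|}.$$ 2. For all $m,n\in\mathbb Z^3$ the function $(x,y)\mapsto G_\omega(x+m,y+n;z)$ is integrable on $C_0\times C_0$, and $$\int_{C_0}d^3x\int_{C_0}d^3y\,\big|G_\omega(x+m,y+n;z)\big|\le C\,e^{-\gamma\|n-m\|}.$$ The same statements, with the same constants, hold for the kernel obtained by replacing $G_0(x,i;z)$ by its complex conjugate in the double series. -/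

import Mathlib

open MeasureTheory

namespace DeltaInteraction

noncomputable section

/-- Euclidean three-space. -/
abbrev R3 : Type := EuclideanSpace ℝ (Fin 3)

/-- The lattice `ℤ³`. -/
abbrev Z3 : Type := Fin 3 → ℤ

/-- The point of `ℝ³` given by a lattice vector. -/
def pt (m : Z3) : R3 := WithLp.toLp 2 (fun i => (m i : ℝ))

/-- The lattice `ℤ³` as a subset of `ℝ³`. -/
def latticeSet : Set R3 := Set.range pt

/-- The distance `d(x)` from `x` to `ℤ³`. -/
def latticeDist (x : R3) : ℝ := Metric.infDist x latticeSet

/-- The closed unit cube centred at the origin. -/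
def unitCube : Set R3 := {x | ∀ i, |x i| ≤ 1 / 2}

/-- The principal branch of the square root. -/
def principalSqrt (z : ℂ) : ℂ := z ^ (1 / 2 : ℂ)

/-- The Green's function of `-Δ`:
`G₀(x, y; z) = exp (i √z ‖x - y‖) / (4 π ‖x - y‖)` for `x ≠ y`. -/
def freeGreen (z : ℂ) (x y : R3) : ℂ :=
  1 / (4 * (Real.pi : ℂ)) *
    (Complex.exp (Complex.I * principalSqrt z * (‖x - y‖ : ℂ)) / (‖x - y‖ : ℂ))

/-- The sites that carry an interaction (`ω j = 0` means that there is none at `j`). -/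
def activeSites (ω : Z3 → ℝ) : Set Z3 := {j | ω j ≠ 0}

open Classical in
/-- The matrix `Γ(z, ω)`, indexed by the active sites. -/
def gammaMatrix (z : ℂ) (ω : Z3 → ℝ) : Matrix (activeSites ω) (activeSites ω) ℂ :=
  fun i j =>
    if i = j then 1 / (ω j : ℂ) - Complex.I * (principalSqrt z / (4 * (Real.pi : ℂ)))
    else - freeGreen z (pt i) (pt j)

/-- The Hilbert space `ℓ²(Λ)` over the set `Λ` of active sites. -/
abbrev ell2 (ω : Z3 → ℝ) : Type := lp (fun _ : activeSites ω => ℂ) 2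

/-- The bounded operator `T` is the two-sided inverse of the operator that `Γ(z, ω)` defines on
`{u ∈ ℓ²(Λ) | Γ u ∈ ℓ²(Λ)}`. This domain is all of `ℓ²(Λ)` when `1 / ω` is bounded on `Λ`. -/
def IsGammaInverse (z : ℂ) (ω : Z3 → ℝ) (T : ell2 ω →L[ℂ] ell2 ω) : Prop :=
  (∀ (v : ell2 ω) (i : activeSites ω),
      HasSum (fun j : activeSites ω => gammaMatrix z ω i j * (T v) j) (v i)) ∧
  (∀ u v : ell2 ω,
      (∀ i : activeSites ω, HasSum (fun j : activeSites ω => gammaMatrix z ω i j * u j) (v i)) →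
        T v = u)

theorem IsGammaInverse.unique {z : ℂ} {ω : Z3 → ℝ} {T S : ell2 ω →L[ℂ] ell2 ω}
    (hT : IsGammaInverse z ω T) (hS : IsGammaInverse z ω S) : T = S :=
  ContinuousLinearMap.ext fun v => hT.2 (S v) v (hS.1 v)

open Classical in
/-- The inverse of `Γ(z, ω)` on `ℓ²(Λ)`, unique by `IsGammaInverse.unique` (and `0` by
convention if there is no bounded inverse). -/
def gammaInv (z : ℂ) (ω : Z3 → ℝ) : ell2 ω →L[ℂ] ell2 ω :=
  if h : ∃ T, IsGammaInverse z ω T then h.choose else 0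

open Classical in
/-- The matrix element `⟨δ_i, Γ(z, ω)⁻¹ δ_j⟩`. -/
def gammaInvEntry (z : ℂ) (ω : Z3 → ℝ) (i j : activeSites ω) : ℂ :=
  (gammaInv z ω (lp.single 2 j (1 : ℂ))) i

/-- The terms `G₀(x, i; z) [Γ(z, ω)⁻¹]_{ij} G₀(j, y; z)` of the interaction series. -/
def interactionTerm (z : ℂ) (ω : Z3 → ℝ) (x y : R3) (p : activeSites ω × activeSites ω) : ℂ :=
  freeGreen z x (pt p.1) * gammaInvEntry z ω p.1 p.2 * freeGreen z (pt p.2) y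

/-- The same terms with the first factor conjugated. -/
def interactionTermConj (z : ℂ) (ω : Z3 → ℝ) (x y : R3)
    (p : activeSites ω × activeSites ω) : ℂ :=
  (starRingEnd ℂ) (freeGreen z x (pt p.1)) * gammaInvEntry z ω p.1 p.2 * freeGreen z (pt p.2) y

/-- The Green's function `G_ω(x, y; z)` of the Hamiltonian with `δ`-interactions. -/
def deltaGreen (z : ℂ) (ω : Z3 → ℝ) (x y : R3) : ℂ :=
  freeGreen z x y + ∑' p : activeSites ω × activeSites ω, interactionTerm z ω x y p

/-- The variant of `deltaGreen` in which `G₀(x, i; z)` is replaced by its complex conjugate. -/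
def deltaGreenConj (z : ℂ) (ω : Z3 → ℝ) (x y : R3) : ℂ :=
  freeGreen z x y + ∑' p : activeSites ω × activeSites ω, interactionTermConj z ω x y p

end

end DeltaInteraction

open DeltaInteraction

/-! Put k = √z; since Im z > 0, both Re k and Im k are positive. The matrix Γ is the real diagonal
1/ω, possibly unbounded, minus a bounded operator A whose kernel (`greenKernel`) is G₀ off the
diagonal and ik/(4π) on it. A real diagonal contributes nothing to imaginary parts of quadratic
forms, so everything follows, uniformly in ω, from the coercivity Im⟨w, A w⟩ ≥ c‖w‖² with c
depending only on z.

Coercivity is a positivity statement in Fourier space. The kernel is symmetric, so the imaginary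
part of its form is the form of the imaginary part of the kernel, that is, of the function `imGreen
k` sampled at lattice differences. The Fourier transform of a spherical wave is 4π/((2π‖w‖)² - k²),
and hence that of `imGreen k` is the strictly positive `spectralDensity k`. The form becomes the
integral of this density against the squared modulus of a trigonometric polynomial; keeping one cell
of the dual lattice and applying Parseval there leaves a positive multiple of the ℓ² norm
(`imGreen_form_lower_bound`). Coercivity gives the inverse (`exists_diagonal_sub_rightInverse`) and
its uniqueness and norm bound (`mul_norm_le_of_im_inner_ge`).

For decay, conjugate by exp(γρ) with ρ 1-Lipschitz. The diagonal is unchanged, and by Schur's test A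
changes by O(γ) in norm (`exists_weight_perturbation`), so half of the coercivity survives for small
γ. The a priori bound for the weighted column of the inverse is then exponential decay of its
entries. The double series is summed with the triangle inequality in the exponent, and the
singularities 1/‖x‖ and 1/‖x - y‖ left over are integrable in dimension three. -/

namespace DeltaInteraction

/-! ### Spherical waves and their Fourier transform -/

/-- The outgoing spherical wave `exp (i κ r) / r`. -/
noncomputable def sphericalWave (κ : ℂ) (r : ℝ) : ℂ := Complex.exp (Complex.I * κ * r) / r

theorem norm_exp_I_mul_mul (κ : ℂ) (r : ℝ) :
    ‖Complex.exp (Complex.I * κ * r)‖ = Real.exp (-κ.im * r) := by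
  rw [Complex.norm_exp]; simp

theorem norm_sphericalWave (κ : ℂ) {r : ℝ} (hr : 0 ≤ r) :
    ‖sphericalWave κ r‖ = Real.exp (-κ.im * r) / r := by
  rw [sphericalWave, norm_div, norm_exp_I_mul_mul, Complex.norm_real, Real.norm_of_nonneg hr]

theorem integrableOn_mul_exp_neg {b : ℝ} (hb : 0 < b) :
    IntegrableOn (fun r : ℝ => r * Real.exp (-b * r)) (Set.Ioi 0) := by
  have := integrableOn_rpow_mul_exp_neg_mul_rpow (p := 1) (s := 1) (by norm_num) one_pos hb
  simpa using this

theorem integrable_sphericalWave {κ : ℂ} (hκ : 0 < κ.im) :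
    Integrable (fun x : R3 => sphericalWave κ ‖x‖) := by
  rw [integrable_fun_norm_addHaar]
  refine (integrableOn_mul_exp_neg hκ).mono' ?_ ?_
  · refine Measurable.aestronglyMeasurable ?_
    unfold sphericalWave
    fun_prop
  · refine (ae_restrict_mem measurableSet_Ioi).mono fun r hr => ?_
    have hr : 0 < r := hr
    rw [norm_smul, norm_sphericalWave κ hr.le]
    simp only [finrank_euclideanSpace, Fintype.card_fin, norm_pow, Real.norm_of_nonneg hr.le]
    apply le_of_eq
    field_simp

theorem hasDerivAt_sqrt_sq_add {s : ℝ} (hs : s ≠ 0) (r : ℝ) :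
    HasDerivAt (fun r : ℝ => √(s ^ 2 + r ^ 2)) (r / √(s ^ 2 + r ^ 2)) r := by
  have h0 : s ^ 2 + r ^ 2 ≠ 0 := by positivity
  have h := ((hasDerivAt_pow 2 r).const_add (s ^ 2)).sqrt h0
  convert! h using 1
  field_simp
  simp [mul_comm]

/-- The radial weight r makes the integrand an exact derivative, that of exp(iκ√(s² + r²))/(iκ),
which vanishes at infinity because Im κ > 0. -/
theorem integral_mul_sphericalWave_sqrt {κ : ℂ} (hκ : 0 < κ.im) {s : ℝ} (hs : s ≠ 0) :
    ∫ r in Set.Ioi (0 : ℝ), r • sphericalWave κ √(s ^ 2 + r ^ 2) =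
      Complex.I * Complex.exp (Complex.I * κ * |s|) / κ := by
  have hκ0 : κ ≠ 0 := by rintro rfl; simp at hκ
  have hpos : ∀ r : ℝ, 0 < √(s ^ 2 + r ^ 2) := fun r => Real.sqrt_pos.2 (by positivity)
  have hle : ∀ r : ℝ, r ≤ √(s ^ 2 + r ^ 2) := fun r => Real.le_sqrt_of_sq_le (by nlinarith)
  have hd : ∀ r ∈ Set.Ici (0 : ℝ), HasDerivAt
      (fun r : ℝ => Complex.exp (Complex.I * κ * (√(s ^ 2 + r ^ 2) : ℝ)) / (Complex.I * κ))
      (r • sphericalWave κ √(s ^ 2 + r ^ 2)) r := by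
    intro r _
    have h := ((((hasDerivAt_sqrt_sq_add hs r).ofReal_comp).const_mul
      (Complex.I * κ)).cexp).div_const (Complex.I * κ)
    convert! h using 1
    have : ((√(s ^ 2 + r ^ 2) : ℝ) : ℂ) ≠ 0 := by exact_mod_cast (hpos r).ne'
    rw [sphericalWave, Complex.real_smul]
    push_cast
    field_simp
  have hi : IntegrableOn (fun r : ℝ => r • sphericalWave κ √(s ^ 2 + r ^ 2)) (Set.Ioi 0) := by
    refine (integrableOn_exp_mul_Ioi (a := -κ.im) (by linarith) 0).mono' ?_ ?_
    · refine Measurable.aestronglyMeasurable ?_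
      unfold sphericalWave
      fun_prop
    · refine (ae_restrict_mem measurableSet_Ioi).mono fun r hr => ?_
      have hr : 0 < r := hr
      rw [norm_smul, norm_sphericalWave κ (hpos r).le, Real.norm_of_nonneg hr.le, mul_div_left_comm]
      refine (mul_le_of_le_one_right (Real.exp_pos _).le
        ((div_le_one (hpos r)).2 (hle r))).trans ?_
      exact Real.exp_le_exp.2 (by nlinarith [hle r])
  have ht : Filter.Tendsto
      (fun r : ℝ => Complex.exp (Complex.I * κ * (√(s ^ 2 + r ^ 2) : ℝ)) / (Complex.I * κ))
      Filter.atTop (nhds 0) := by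
    rw [← zero_div (Complex.I * κ)]
    refine Filter.Tendsto.div_const ?_ _
    rw [tendsto_zero_iff_norm_tendsto_zero]
    simp_rw [norm_exp_I_mul_mul]
    refine Real.tendsto_exp_atBot.comp ?_
    refine Filter.Tendsto.const_mul_atTop_of_neg (by linarith) ?_
    exact Filter.tendsto_atTop_mono hle Filter.tendsto_id
  rw [integral_Ioi_of_hasDerivAt_of_tendsto' hd hi ht]
  simp only [ne_eq, OfNat.ofNat_ne_zero, not_false_eq_true, zero_pow, add_zero, Real.sqrt_sq_eq_abs]
  field_simp
  simp

theorem integral_sphericalWave_plane {κ : ℂ} (hκ : 0 < κ.im) {s : ℝ} (hs : s ≠ 0) :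
    ∫ y : EuclideanSpace ℝ (Fin 2), sphericalWave κ √(s ^ 2 + ‖y‖ ^ 2) =
      2 * Real.pi * Complex.I / κ * Complex.exp (Complex.I * κ * |s|) := by
  rw [integral_fun_norm_addHaar volume (fun r : ℝ => sphericalWave κ √(s ^ 2 + r ^ 2))]
  simp only [finrank_euclideanSpace, Fintype.card_fin, Nat.add_one_sub_one, pow_one]
  rw [integral_mul_sphericalWave_sqrt hκ hs, Measure.real, EuclideanSpace.volume_ball_fin_two]
  simp [Real.pi_pos.le]
  ring

theorem integral_exp_mul_exp_abs {κ : ℂ} (hκ : 0 < κ.im) (q : ℝ) :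
    ∫ s : ℝ, Complex.exp (-(Complex.I * q * s)) * Complex.exp (Complex.I * κ * |s|) =
      2 * κ * Complex.I / (κ ^ 2 - q ^ 2) := by
  have h1 : ∀ s ∈ Set.Iic (0 : ℝ),
      Complex.exp (-(Complex.I * q * s)) * Complex.exp (Complex.I * κ * |s|) =
      Complex.exp ((-Complex.I * (q + κ)) * s) := by
    intro s hs
    rw [← Complex.exp_add, abs_of_nonpos hs]; push_cast; ring_nf
  have h2 : ∀ s ∈ Set.Ioi (0 : ℝ),
      Complex.exp (-(Complex.I * q * s)) * Complex.exp (Complex.I * κ * |s|) =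
      Complex.exp ((Complex.I * (κ - q)) * s) := by
    intro s hs
    rw [← Complex.exp_add, abs_of_pos hs]; ring_nf
  have r1 : 0 < (-Complex.I * (q + κ)).re := by simpa
  have r2 : (Complex.I * (κ - q)).re < 0 := by simpa
  have i1 : IntegrableOn (fun s : ℝ => Complex.exp (-(Complex.I * q * s)) *
      Complex.exp (Complex.I * κ * |s|)) (Set.Iic 0) :=
    (integrableOn_congr_fun h1 measurableSet_Iic).2 (integrableOn_exp_mul_complex_Iic r1 0)
  have i2 : IntegrableOn (fun s : ℝ => Complex.exp (-(Complex.I * q * s)) *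
      Complex.exp (Complex.I * κ * |s|)) (Set.Ioi 0) :=
    (integrableOn_congr_fun h2 measurableSet_Ioi).2 (integrableOn_exp_mul_complex_Ioi r2 0)
  rw [← intervalIntegral.integral_Iic_add_Ioi i1 i2, setIntegral_congr_fun measurableSet_Iic h1,
    setIntegral_congr_fun measurableSet_Ioi h2, integral_exp_mul_complex_Iic r1,
    integral_exp_mul_complex_Ioi r2]
  have n1 : (q : ℂ) + κ ≠ 0 := fun h => by rw [h] at r1; simp at r1
  have n2 : κ - (q : ℂ) ≠ 0 := fun h => by rw [h] at r2; simp at r2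
  have n3 : κ ^ 2 - (q : ℂ) ^ 2 ≠ 0 := by
    rw [show κ ^ 2 - (q : ℂ) ^ 2 = (q + κ) * (κ - q) by ring]; exact mul_ne_zero n1 n2
  simp only [Complex.ofReal_zero, mul_zero, Complex.exp_zero]
  field_simp
  rw [Complex.I_sq]
  ring

/-- The decomposition `ℝ³ = ℝ × ℝ²`. -/
noncomputable def splitFirst : R3 ≃ᵐ ℝ × EuclideanSpace ℝ (Fin 2) :=
  ((MeasurableEquiv.toLp 2 (Fin 3 → ℝ)).symm.trans
    (MeasurableEquiv.piFinSuccAbove (fun _ => ℝ) 0)).trans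
    (MeasurableEquiv.prodCongr (MeasurableEquiv.refl ℝ) (MeasurableEquiv.toLp 2 (Fin 2 → ℝ)))

theorem measurePreserving_splitFirst : MeasurePreserving splitFirst := by
  refine MeasurePreserving.trans (MeasurePreserving.trans
    (EuclideanSpace.volume_preserving_symm_measurableEquiv_toLp (Fin 3))
    (volume_preserving_piFinSuccAbove (fun _ : Fin 3 => ℝ) 0)) ?_
  exact (MeasurePreserving.id volume).prod (PiLp.volume_preserving_toLp (Fin 2))

theorem splitFirst_fst (x : R3) : (splitFirst x).1 = x 0 := rfl

theorem norm_eq_sqrt_splitFirst (x : R3) :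
    ‖x‖ = √((splitFirst x).1 ^ 2 + ‖(splitFirst x).2‖ ^ 2) := by
  have h1 : (splitFirst x).2 0 = x 1 := rfl
  have h2 : (splitFirst x).2 1 = x 2 := rfl
  rw [EuclideanSpace.norm_eq, EuclideanSpace.real_norm_sq_eq, Fin.sum_univ_two, h1, h2,
    splitFirst_fst, Fin.sum_univ_three]
  simp [add_assoc]

/-- The integral of a spherical wave against a plane wave along the first axis. -/
theorem integral_planeWave_mul_sphericalWave {κ : ℂ} (hκ : 0 < κ.im) (q : ℝ) :
    ∫ x : R3, Complex.exp (-(Complex.I * q * (x 0 : ℝ))) * sphericalWave κ ‖x‖ =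
      4 * Real.pi / (q ^ 2 - κ ^ 2) := by
  have hκ0 : κ ≠ 0 := by rintro rfl; simp at hκ
  set F : ℝ × EuclideanSpace ℝ (Fin 2) → ℂ := fun p =>
    Complex.exp (-(Complex.I * q * (p.1 : ℝ))) * sphericalWave κ √(p.1 ^ 2 + ‖p.2‖ ^ 2) with hF
  have hcomp : ∀ x : R3, Complex.exp (-(Complex.I * q * (x 0 : ℝ))) * sphericalWave κ ‖x‖ =
      F (splitFirst x) := fun x => by
    rw [norm_eq_sqrt_splitFirst, ← splitFirst_fst]
  have hint : Integrable (fun x : R3 =>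
      Complex.exp (-(Complex.I * q * (x 0 : ℝ))) * sphericalWave κ ‖x‖) := by
    refine (integrable_sphericalWave hκ).bdd_mul (c := 1) ?_ ?_
    · refine Continuous.aestronglyMeasurable ?_
      fun_prop
    · refine Filter.Eventually.of_forall fun x => ?_
      rw [Complex.norm_exp]; simp
  simp_rw [hcomp] at hint ⊢
  rw [measurePreserving_splitFirst.integral_comp splitFirst.measurableEmbedding F]
  have hintF : Integrable F (volume.prod volume) :=
    (measurePreserving_splitFirst.integrable_comp_emb splitFirst.measurableEmbedding).1 hint
  rw [show (volume : Measure (ℝ × EuclideanSpace ℝ (Fin 2))) = volume.prod volume from rfl,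
    integral_prod F hintF]
  -- Fubini over the planes x₀ = s. The plane through the pole, s = 0, is a null set of slices and
  -- is discarded.
  have hs : ∀ᵐ s : ℝ, ∫ y, F (s, y) = 2 * Real.pi * Complex.I / κ *
      (Complex.exp (-(Complex.I * q * s)) * Complex.exp (Complex.I * κ * |s|)) := by
    filter_upwards [compl_mem_ae_iff.2 (measure_singleton (0 : ℝ))] with s hs
    simp only [hF]
    rw [integral_const_mul, integral_sphericalWave_plane hκ hs]
    ring
  rw [integral_congr_ae hs, integral_const_mul, integral_exp_mul_exp_abs hκ]
  have h0 : 2 * Real.pi * Complex.I / κ * (2 * κ * Complex.I / (κ ^ 2 - (q : ℂ) ^ 2)) =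
    4 * Real.pi * (Complex.I ^ 2) * (κ / κ) / (κ ^ 2 - (q : ℂ) ^ 2) := by ring
  rw [h0, Complex.I_sq, div_self hκ0, ← neg_sub ((q : ℂ) ^ 2), div_neg]
  ring

/-- The Fourier transform of a spherical wave. -/
theorem fourier_sphericalWave {κ : ℂ} (hκ : 0 < κ.im) (w : R3) :
    FourierTransform.fourier (fun x : R3 => sphericalWave κ ‖x‖) w =
      4 * Real.pi / ((2 * Real.pi * ‖w‖ : ℝ) ^ 2 - κ ^ 2) := by
  -- A reflection carries ‖w‖e₀ to w, so rotational symmetry reduces every frequency to one along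
  -- the first axis.
  obtain ⟨A, hA⟩ : ∃ A : R3 ≃ₗᵢ[ℝ] R3, A (EuclideanSpace.single 0 ‖w‖) = w :=
    ⟨_, Submodule.reflection_sub (v := EuclideanSpace.single 0 ‖w‖) (w := w) (by simp)⟩
  rw [Real.fourier_eq', ← integral_planeWave_mul_sphericalWave hκ,
    ← A.measurePreserving.integral_comp A.toMeasurableEquiv.measurableEmbedding]
  refine integral_congr_ae (Filter.Eventually.of_forall fun x => ?_)
  have h : inner ℝ (A x) w = ‖w‖ * x 0 := by
    conv_lhs => rw [← hA]
    rw [A.inner_map_map, EuclideanSpace.inner_single_right]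
    simp
  simp only [h, A.norm_map, smul_eq_mul]
  push_cast
  ring_nf

/-! ### The imaginary part of the Green's function and its spectral density -/

/-- The continuous extension of the imaginary part of `exp (i k ‖x‖) / (4 π ‖x‖)`. -/
noncomputable def imGreen (k : ℂ) (x : R3) : ℝ :=
  k.re * Real.exp (-k.im * ‖x‖) * Real.sinc (k.re * ‖x‖) / (4 * Real.pi)

/-- The Fourier transform of `imGreen k`. -/
noncomputable def spectralDensity (k : ℂ) (w : R3) : ℝ :=
  2 * k.re * k.im / ‖(((2 * Real.pi * ‖w‖ : ℝ) : ℂ)) ^ 2 - k ^ 2‖ ^ 2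

theorem continuous_imGreen (k : ℂ) : Continuous (imGreen k) := by
  unfold imGreen
  have := Real.continuous_sinc
  fun_prop

/-- This is the imaginary part of ik/(4π): the diagonal entry of `greenKernel` is exactly what
continuity at the pole demands. -/
theorem imGreen_zero (k : ℂ) : imGreen k 0 = k.re / (4 * Real.pi) := by
  simp [imGreen]

theorem imGreen_eq_im {k : ℂ} (hk : k.re ≠ 0) {x : R3} (hx : x ≠ 0) :
    imGreen k x = (sphericalWave k ‖x‖ / (4 * Real.pi)).im := by
  have hn : ‖x‖ ≠ 0 := norm_ne_zero_iff.2 hx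
  have h1 : (4 * (Real.pi : ℂ)) = ((4 * Real.pi : ℝ) : ℂ) := by push_cast; rfl
  rw [h1, sphericalWave, Complex.div_ofReal_im, Complex.div_ofReal_im, Complex.exp_im, imGreen,
    Real.sinc_of_ne_zero (mul_ne_zero hk hn)]
  simp only [Complex.mul_re, Complex.mul_im, Complex.I_re, Complex.I_im, Complex.ofReal_re,
    Complex.ofReal_im]
  ring_nf
  field_simp

/-- Conjugating a wave replaces its wave number k by minus the conjugate of k, which still has
positive imaginary part. The Fourier transform computed above therefore applies to both terms. -/
theorem imGreen_eq_sub {k : ℂ} (hk : k.re ≠ 0) {x : R3} (hx : x ≠ 0) :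
    (imGreen k x : ℂ) = (8 * Real.pi * Complex.I)⁻¹ •
      (sphericalWave k ‖x‖ - sphericalWave (-(starRingEnd ℂ) k) ‖x‖) := by
  have h1 : sphericalWave (-(starRingEnd ℂ) k) ‖x‖ = (starRingEnd ℂ) (sphericalWave k ‖x‖) := by
    simp only [sphericalWave, map_div₀, Complex.conj_ofReal, ← Complex.exp_conj, map_mul,
      Complex.conj_I]
    ring_nf
  have h2 : (4 * (Real.pi : ℂ)) = ((4 * Real.pi : ℝ) : ℂ) := by push_cast; rfl
  have hp : (Real.pi : ℂ) ≠ 0 := by exact_mod_cast Real.pi_ne_zero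
  rw [imGreen_eq_im hk hx, h1, h2, Complex.div_ofReal_im, Complex.sub_conj, smul_eq_mul]
  push_cast
  have := Complex.I_ne_zero
  field_simp
  ring

/-- With Q = (2π‖w‖)² - k², the two transforms are proportional to 1/Q and to its conjugate, and
their difference has numerator conj Q - Q = 4i Re k Im k, a constant of definite sign. -/
theorem fourier_imGreen {k : ℂ} (hre : 0 < k.re) (him : 0 < k.im) (w : R3) :
    FourierTransform.fourier (fun x : R3 => (imGreen k x : ℂ)) w = spectralDensity k w := by
  have him' : 0 < (-(starRingEnd ℂ) k).im := by simpa
  have i1 := integrable_sphericalWave him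
  have i2 := integrable_sphericalWave him'
  have hae : (fun x : R3 => (imGreen k x : ℂ)) =ᵐ[volume]
      (8 * Real.pi * Complex.I)⁻¹ • ((fun x : R3 => sphericalWave k ‖x‖) -
        fun x : R3 => sphericalWave (-(starRingEnd ℂ) k) ‖x‖) := by
    filter_upwards [compl_mem_ae_iff.2 (measure_singleton (0 : R3))] with x hx
    exact imGreen_eq_sub hre.ne' hx
  have hq : ((2 * Real.pi * ‖w‖ : ℝ) : ℂ) ^ 2 - k ^ 2 ≠ 0 := by
    intro h
    have h' := congrArg Complex.im h
    rw [← Complex.ofReal_pow, Complex.sub_im, Complex.ofReal_im, pow_two k, Complex.mul_im,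
      Complex.zero_im] at h'
    nlinarith [mul_pos hre him]
  have hlin : FourierTransform.fourier (fun x : R3 => (imGreen k x : ℂ)) w =
      (8 * Real.pi * Complex.I)⁻¹ *
        (FourierTransform.fourier (fun x : R3 => sphericalWave k ‖x‖) w -
        FourierTransform.fourier (fun x : R3 => sphericalWave (-(starRingEnd ℂ) k) ‖x‖) w) := by
    have j1 := (Real.fourierIntegral_convergent_iff w).2 i1
    have j2 := (Real.fourierIntegral_convergent_iff w).2 i2
    simp only [Real.fourier_eq]
    rw [← integral_sub j1 j2, ← integral_const_mul]
    refine integral_congr_ae ?_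
    filter_upwards [hae] with x hx
    rw [hx]
    simp only [Pi.smul_apply, Pi.sub_apply, Circle.smul_def, smul_eq_mul]
    ring
  rw [hlin, fourier_sphericalWave him, fourier_sphericalWave him', spectralDensity]
  set Q : ℂ := ((2 * Real.pi * ‖w‖ : ℝ) : ℂ) ^ 2 - k ^ 2 with hQ
  have hc : ((2 * Real.pi * ‖w‖ : ℝ) : ℂ) ^ 2 - (-(starRingEnd ℂ) k) ^ 2 = (starRingEnd ℂ) Q := by
    rw [hQ, map_sub, map_pow, map_pow, Complex.conj_ofReal, neg_sq]
  have hQc : (starRingEnd ℂ) Q ≠ 0 := (map_ne_zero _).2 hq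
  have hn : ((‖Q‖ ^ 2 : ℝ) : ℂ) = Q * (starRingEnd ℂ) Q := by
    rw [Complex.mul_conj, Complex.normSq_eq_norm_sq]
  have hd : (starRingEnd ℂ) Q - Q = 4 * k.re * k.im * Complex.I := by
    rw [hQ, map_sub, map_pow, map_pow, Complex.conj_ofReal]
    have e : k = k.re + k.im * Complex.I := (Complex.re_add_im k).symm
    have e' : (starRingEnd ℂ) k = k.re - k.im * Complex.I := by
      apply Complex.ext <;> simp
    rw [e']
    conv_lhs => rw [e]
    simp only [Complex.add_re, Complex.ofReal_re, Complex.mul_re, Complex.I_re, Complex.ofReal_im,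
      Complex.I_im, Complex.add_im, Complex.mul_im]
    push_cast
    ring
  rw [hc, Complex.ofReal_div, hn]
  have hp : (Real.pi : ℂ) ≠ 0 := by exact_mod_cast Real.pi_ne_zero
  have hI := Complex.I_ne_zero
  rw [div_sub_div _ _ hq hQc, mul_comm Q (4 * (Real.pi : ℂ)), ← mul_sub, hd]
  push_cast
  field_simp
  ring

/-- The imaginary part of q² - k² does not depend on q, so the denominator of the spectral density
stays away from zero. -/
theorem two_mul_re_mul_im_le_norm {k : ℂ} (q : ℝ) :
    2 * k.re * k.im ≤ ‖(q : ℂ) ^ 2 - k ^ 2‖ := by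
  refine le_trans ?_ (Complex.abs_im_le_norm _)
  rw [← Complex.ofReal_pow, Complex.sub_im, Complex.ofReal_im, pow_two k, Complex.mul_im]
  refine le_trans ?_ (neg_le_abs _)
  linarith

theorem spectralDensity_nonneg {k : ℂ} (hre : 0 < k.re) (him : 0 < k.im) (w : R3) :
    0 ≤ spectralDensity k w := by
  unfold spectralDensity; positivity

theorem continuous_spectralDensity {k : ℂ} (hre : 0 < k.re) (him : 0 < k.im) :
    Continuous (spectralDensity k) := by
  unfold spectralDensity
  refine Continuous.div continuous_const (by fun_prop) fun w => ?_
  have h := two_mul_re_mul_im_le_norm (k := k) (2 * Real.pi * ‖w‖)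
  have : 0 < 2 * k.re * k.im := by positivity
  exact pow_ne_zero 2 (this.trans_le h).ne'

/-- The density decays like ‖w‖⁻⁴, which is integrable in dimension three. -/
theorem integrable_spectralDensity {k : ℂ} (hre : 0 < k.re) (him : 0 < k.im) :
    Integrable (spectralDensity k) := by
  set y := 2 * k.re * k.im with hy
  have hy0 : 0 < y := by positivity
  -- Chosen so that y(1 + ‖w‖²) ≤ cN: the bounds y ≤ N and ‖w‖² ≤ N + ‖k‖² give y + y‖w‖² ≤ N + yN +
  -- ‖k‖²N.
  set c := y + 1 + ‖k‖ ^ 2 with hc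
  have hc0 : 0 < c := by positivity
  have hI := (integrable_rpow_neg_one_add_norm_sq (E := R3) (μ := volume) (r := 4)
    (by simp; norm_num)).const_mul (y * (c / y) ^ 2)
  refine hI.mono' (continuous_spectralDensity hre him).aestronglyMeasurable
    (Filter.Eventually.of_forall fun w => ?_)
  rw [Real.norm_of_nonneg (spectralDensity_nonneg hre him w), spectralDensity]
  set N := ‖(((2 * Real.pi * ‖w‖ : ℝ) : ℂ)) ^ 2 - k ^ 2‖ with hN
  have h1 : y ≤ N := two_mul_re_mul_im_le_norm _
  have h2 : (2 * Real.pi * ‖w‖) ^ 2 - ‖k‖ ^ 2 ≤ N := by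
    have := norm_sub_norm_le ((((2 * Real.pi * ‖w‖ : ℝ) : ℂ)) ^ 2) (k ^ 2)
    rw [norm_pow, norm_pow, Complex.norm_real, Real.norm_of_nonneg (by positivity)] at this
    exact this
  have h3 : ‖w‖ ^ 2 ≤ (2 * Real.pi * ‖w‖) ^ 2 := by
    have : (1 : ℝ) ≤ 2 * Real.pi := by linarith [Real.pi_gt_three]
    have h := mul_le_mul_of_nonneg_right this (norm_nonneg w)
    rw [one_mul] at h
    exact pow_le_pow_left₀ (norm_nonneg w) h 2
  have h4 : y * (1 + ‖w‖ ^ 2) ≤ c * N := by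
    nlinarith [mul_le_mul_of_nonneg_left (h3.trans (by linarith [h2] :
      (2 * Real.pi * ‖w‖) ^ 2 ≤ N + ‖k‖ ^ 2)) hy0.le,
      mul_le_mul_of_nonneg_right h1 (sq_nonneg ‖k‖)]
  have hN0 : 0 < N := hy0.trans_le h1
  have hw : 0 < 1 + ‖w‖ ^ 2 := by positivity
  have e : (1 + ‖w‖ ^ 2) ^ (-4 / 2 : ℝ) = ((1 + ‖w‖ ^ 2) ^ 2)⁻¹ := by
    rw [show (-4 / 2 : ℝ) = -((2 : ℕ) : ℝ) by norm_num, Real.rpow_neg hw.le, Real.rpow_natCast]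
  rw [e, ← hy, mul_assoc, div_eq_mul_inv]
  refine mul_le_mul_of_nonneg_left ?_ hy0.le
  rw [← inv_pow, ← inv_pow, ← mul_pow]
  refine pow_le_pow_left₀ (inv_nonneg.2 hN0.le) ?_ 2
  rw [inv_eq_one_div, div_le_iff₀ hN0]
  have : c / y * (1 + ‖w‖ ^ 2)⁻¹ * N = (c * N) / (y * (1 + ‖w‖ ^ 2)) := by field_simp
  rw [this, le_div_iff₀ (by positivity), one_mul]
  exact h4

theorem integrable_imGreen {k : ℂ} (hre : 0 < k.re) (him : 0 < k.im) :
    Integrable (fun x : R3 => (imGreen k x : ℂ)) := by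
  have him' : 0 < (-(starRingEnd ℂ) k).im := by simpa
  have h := ((integrable_sphericalWave him).sub (integrable_sphericalWave him')).smul
    (8 * (Real.pi : ℂ) * Complex.I)⁻¹
  refine h.congr ?_
  filter_upwards [compl_mem_ae_iff.2 (measure_singleton (0 : R3))] with x hx
  exact (imGreen_eq_sub hre.ne' hx).symm

/-- The spectral representation of `imGreen k`. -/
theorem imGreen_eq_integral {k : ℂ} (hre : 0 < k.re) (him : 0 < k.im) (x : R3) :
    (imGreen k x : ℂ) = ∫ w : R3,
      Complex.exp ((2 * Real.pi * inner ℝ w x : ℝ) * Complex.I) * spectralDensity k w := by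
  have hF : FourierTransform.fourier (fun x : R3 => (imGreen k x : ℂ)) =
      fun w => (spectralDensity k w : ℂ) := funext (fourier_imGreen hre him)
  have hcont : Continuous (fun x : R3 => (imGreen k x : ℂ)) :=
    Complex.continuous_ofReal.comp (continuous_imGreen k)
  -- Inversion is pointwise at every x because `imGreen k` is continuous; the point x = 0 is needed
  -- for the diagonal of the lattice matrix.
  have h := (integrable_imGreen hre him).fourierInv_fourier_eq
    (by rw [hF]; exact (integrable_spectralDensity hre him).ofReal) (hcont.continuousAt (x := x))
  rw [← h, hF, Real.fourierInv_eq']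
  rfl

/-! ### Plane waves on the dual cell and coercivity on the lattice -/

/-- The cell `(0, 1]³` of the dual lattice. -/
def dualCell : Set R3 := (WithLp.ofLp : R3 → Fin 3 → ℝ) ⁻¹' Set.univ.pi fun _ => Set.Ioc 0 1

/-- The plane waves `exp (2 π i w · m)`, `m ∈ ℤ³`. -/
noncomputable def latticeWave (m : Z3) (w : R3) : ℂ :=
  Complex.exp ((2 * Real.pi * inner ℝ w (pt m) : ℝ) * Complex.I)

theorem pt_sub (m n : Z3) : pt (m - n) = pt m - pt n := by
  ext i; simp [pt]

theorem inner_pt (w : R3) (m : Z3) : inner ℝ w (pt m) = ∑ i, w i * m i := by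
  simp [PiLp.inner_apply, pt, mul_comm]

theorem continuous_latticeWave (m : Z3) : Continuous (latticeWave m) := by
  unfold latticeWave; fun_prop

theorem norm_latticeWave (m : Z3) (w : R3) : ‖latticeWave m w‖ = 1 :=
  Complex.norm_exp_ofReal_mul_I _

theorem latticeWave_sub (m n : Z3) (w : R3) :
    latticeWave (m - n) w = latticeWave m w * (starRingEnd ℂ) (latticeWave n w) := by
  simp only [latticeWave, ← Complex.exp_conj, ← Complex.exp_add, pt_sub, inner_sub_right, map_mul,
    Complex.conj_ofReal, Complex.conj_I]
  push_cast
  ring_nf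

theorem integral_Ioc_exp_int (n : ℤ) :
    ∫ t in Set.Ioc (0 : ℝ) 1, Complex.exp (n * (2 * Real.pi * Complex.I) * t) =
      if n = 0 then 1 else 0 := by
  split_ifs with h
  · simp [h]
  · rw [← intervalIntegral.integral_of_le zero_le_one, integral_exp_mul_complex]
    · rw [Complex.ofReal_one, mul_one, Complex.exp_int_mul_two_pi_mul_I]
      simp
    · exact mul_ne_zero (by exact_mod_cast h) Complex.two_pi_I_ne_zero

theorem measurableSet_dualCell : MeasurableSet dualCell :=
  (MeasurableSet.univ_pi fun _ => measurableSet_Ioc).preimage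
    (PiLp.volume_preserving_ofLp _).measurable

theorem volume_dualCell : volume dualCell = 1 := by
  rw [dualCell, (PiLp.volume_preserving_ofLp (Fin 3)).measure_preimage
    (MeasurableSet.univ_pi fun _ => measurableSet_Ioc).nullMeasurableSet, volume_pi_pi]
  simp

theorem integral_latticeWave (m : Z3) :
    ∫ w in dualCell, latticeWave m w = if m = 0 then 1 else 0 := by
  have h1 : ∀ w : R3, latticeWave m w =
      (fun v : Fin 3 → ℝ => ∏ i, Complex.exp (m i * (2 * Real.pi * Complex.I) * v i)) w.ofLp := by
    intro w
    simp only [latticeWave, inner_pt, ← Complex.exp_sum]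
    push_cast
    rw [Finset.mul_sum, Finset.sum_mul]
    exact congrArg _ (Finset.sum_congr rfl fun i _ => by ring)
  simp_rw [h1]
  refine ((PiLp.volume_preserving_ofLp (Fin 3)).setIntegral_preimage_emb
    (MeasurableEquiv.toLp 2 (Fin 3 → ℝ)).symm.measurableEmbedding (fun v : Fin 3 → ℝ =>
      ∏ i, Complex.exp (m i * (2 * Real.pi * Complex.I) * v i)) _).trans ?_
  rw [volume_pi, Measure.restrict_pi_pi]
  rw [integral_fintype_prod_eq_prod
    (fun i (t : ℝ) => Complex.exp (m i * (2 * Real.pi * Complex.I) * t))]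
  simp_rw [integral_Ioc_exp_int]
  split_ifs with h
  · simp [h]
  · obtain ⟨i, hi⟩ := Function.ne_iff.1 h
    exact Finset.prod_eq_zero (Finset.mem_univ i) (if_neg hi)

/-- The square of a trigonometric polynomial as a double sum. -/
theorem norm_sq_trigPoly (s : Finset Z3) (u : Z3 → ℂ) (w : R3) :
    ((‖∑ j ∈ s, u j * latticeWave (-j) w‖ ^ 2 : ℝ) : ℂ) =
      ∑ i ∈ s, ∑ j ∈ s, (starRingEnd ℂ) (u i) * u j * latticeWave (i - j) w := by
  have hneg : ∀ j, latticeWave (-j) w = (starRingEnd ℂ) (latticeWave j w) := fun j => by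
    rw [← zero_sub, latticeWave_sub]
    simp [latticeWave, inner_pt]
  rw [← Complex.normSq_eq_norm_sq, Complex.normSq_eq_conj_mul_self, map_sum, Finset.sum_mul_sum]
  refine Finset.sum_congr rfl fun i _ => Finset.sum_congr rfl fun j _ => ?_
  rw [latticeWave_sub, hneg, hneg, map_mul, Complex.conj_conj]
  ring

/-- Parseval: the lattice waves are orthonormal on the cell, so only the diagonal of the double sum
survives. -/
theorem integral_dualCell_trigPoly (s : Finset Z3) (u : Z3 → ℂ) :
    ∫ w in dualCell, ‖∑ j ∈ s, u j * latticeWave (-j) w‖ ^ 2 = ∑ j ∈ s, ‖u j‖ ^ 2 := by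
  have hfin : IsFiniteMeasure (volume.restrict dualCell) :=
    ⟨by simp [volume_dualCell]⟩
  have hI : ∀ (c : ℂ) (m : Z3), Integrable (fun w => c * latticeWave m w)
      (volume.restrict dualCell) := fun c m =>
    (Integrable.of_bound (continuous_latticeWave m).aestronglyMeasurable 1
      (Filter.Eventually.of_forall fun w => (norm_latticeWave m w).le)).const_mul c
  rw [← Complex.ofReal_inj, ← integral_complex_ofReal]
  simp_rw [norm_sq_trigPoly]
  rw [integral_finsetSum _ fun i _ => integrable_finsetSum _ fun j _ => hI _ _, Complex.ofReal_sum]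
  refine Finset.sum_congr rfl fun i hi => ?_
  rw [integral_finsetSum _ fun j _ => hI _ _, Finset.sum_eq_single i]
  · rw [integral_const_mul, integral_latticeWave, sub_self, if_pos rfl, mul_one,
      ← Complex.normSq_eq_conj_mul_self, Complex.normSq_eq_norm_sq]
  · intro j _ hj
    rw [integral_const_mul, integral_latticeWave, if_neg (sub_ne_zero.2 hj.symm), mul_zero]
  · exact fun h => absurd hi h

/-- The density tends to zero at infinity, so a positive lower bound is available only on bounded
sets; one cell, where ‖w‖² ≤ 3, suffices. -/
theorem spectralDensity_lower_bound {k : ℂ} (hre : 0 < k.re) (him : 0 < k.im) :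
    ∃ c : ℝ, 0 < c ∧ ∀ w ∈ dualCell, c ≤ spectralDensity k w := by
  refine ⟨2 * k.re * k.im / ((2 * Real.pi) ^ 2 * 3 + ‖k‖ ^ 2) ^ 2, by positivity, fun w hw => ?_⟩
  have hw' : ‖w‖ ^ 2 ≤ 3 := by
    have h : ∀ i, w i ^ 2 ≤ 1 := fun i => by
      have := hw i (Set.mem_univ i)
      simp only [Set.mem_Ioc] at this
      nlinarith [this.1, this.2]
    rw [EuclideanSpace.real_norm_sq_eq, Fin.sum_univ_three]
    linarith [h 0, h 1, h 2]
  have hN := two_mul_re_mul_im_le_norm (k := k) (2 * Real.pi * ‖w‖)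
  have h0 : 0 < 2 * k.re * k.im := by positivity
  have hp := h0.trans_le hN
  unfold spectralDensity
  refine div_le_div_of_nonneg_left h0.le (by positivity) (pow_le_pow_left₀ hp.le ?_ 2)
  refine (norm_sub_le _ _).trans ?_
  rw [norm_pow, norm_pow, Complex.norm_real, Real.norm_of_nonneg (by positivity), mul_pow]
  gcongr

/-- The lattice matrix of `imGreen k` is bounded below by a positive constant. -/
theorem imGreen_form_lower_bound {k : ℂ} (hre : 0 < k.re) (him : 0 < k.im) :
    ∃ c : ℝ, 0 < c ∧ ∀ (s : Finset Z3) (u : Z3 → ℂ), c * ∑ j ∈ s, ‖u j‖ ^ 2 ≤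
      (∑ i ∈ s, ∑ j ∈ s, (starRingEnd ℂ) (u i) * u j * (imGreen k (pt i - pt j) : ℂ)).re := by
  obtain ⟨c, hc, hcw⟩ := spectralDensity_lower_bound hre him
  refine ⟨c, hc, fun s u => ?_⟩
  have hσ := (integrable_spectralDensity hre him)
  have hI : ∀ (a : ℂ) (m : Z3), Integrable
      (fun w : R3 => a * (latticeWave m w * spectralDensity k w)) := fun a m =>
    (hσ.ofReal.bdd_mul (c := 1) (continuous_latticeWave m).aestronglyMeasurable
      (Filter.Eventually.of_forall fun w => (norm_latticeWave m w).le)).const_mul a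
  have hform : (∑ i ∈ s, ∑ j ∈ s, (starRingEnd ℂ) (u i) * u j *
      (imGreen k (pt i - pt j) : ℂ)) = ((∫ w : R3, spectralDensity k w *
        ‖∑ j ∈ s, u j * latticeWave (-j) w‖ ^ 2 : ℝ) : ℂ) := by
    rw [← integral_complex_ofReal]
    have : ∀ w : R3, ((spectralDensity k w * ‖∑ j ∈ s, u j * latticeWave (-j) w‖ ^ 2 : ℝ) : ℂ) =
        ∑ i ∈ s, ∑ j ∈ s, (starRingEnd ℂ) (u i) * u j *
          (latticeWave (i - j) w * spectralDensity k w) := fun w => by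
      rw [Complex.ofReal_mul, norm_sq_trigPoly, Finset.mul_sum]
      refine Finset.sum_congr rfl fun i _ => ?_
      rw [Finset.mul_sum]
      exact Finset.sum_congr rfl fun j _ => by ring
    simp_rw [this]
    rw [integral_finsetSum _ fun i _ => integrable_finsetSum _ fun j _ => hI _ _]
    refine Finset.sum_congr rfl fun i _ => ?_
    rw [integral_finsetSum _ fun j _ => hI _ _]
    refine Finset.sum_congr rfl fun j _ => ?_
    rw [integral_const_mul, ← pt_sub, imGreen_eq_integral hre him]
    rfl
  have hcontP : Continuous fun w : R3 => ‖∑ j ∈ s, u j * latticeWave (-j) w‖ ^ 2 := by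
    have := continuous_latticeWave
    fun_prop
  have hint : Integrable (fun w : R3 => spectralDensity k w *
      ‖∑ j ∈ s, u j * latticeWave (-j) w‖ ^ 2) := by
    refine hσ.mul_bdd (c := (∑ j ∈ s, ‖u j‖) ^ 2) hcontP.aestronglyMeasurable
      (Filter.Eventually.of_forall fun w => ?_)
    rw [norm_pow, norm_norm]
    refine pow_le_pow_left₀ (norm_nonneg _) ((norm_sum_le _ _).trans_eq ?_) 2
    simp [norm_latticeWave]
  have hfin : IsFiniteMeasure (volume.restrict dualCell) :=
    ⟨by simp [volume_dualCell]⟩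
  rw [hform, Complex.ofReal_re, ← integral_dualCell_trigPoly, ← integral_const_mul]
  -- The integrand is nonnegative, so restricting to one cell only decreases the integral.
  refine le_trans ?_ (setIntegral_le_integral (s := dualCell) hint (Filter.Eventually.of_forall
    fun w => mul_nonneg (spectralDensity_nonneg hre him w) (by positivity)))
  refine integral_mono_of_nonneg (Filter.Eventually.of_forall fun w => by positivity)
    hint.integrableOn ?_
  refine (ae_restrict_mem measurableSet_dualCell).mono fun w hw => ?_
  exact mul_le_mul_of_nonneg_right (hcw w hw) (by positivity)

/-! ### Operators on ℓ²: Schur's test and inversion by coercivity -/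

section Operators

variable {ι : Type*}

theorem lp_hasSum_norm_sq (u : lp (fun _ : ι => ℂ) 2) :
    HasSum (fun i => ‖u i‖ ^ 2) (‖u‖ ^ 2) := by
  have h := lp.hasSum_norm (p := 2) (by norm_num) u
  simpa using h

/-- Weighted Cauchy–Schwarz, from the discriminant of the nonnegative quadratic t ↦ ∑ aⱼ(t - xⱼ)².
-/
theorem sq_tsum_mul_le {a x : ι → ℝ} {S : ℝ} (ha : ∀ j, 0 ≤ a j) (hs : Summable a) (hS : ∑' j, a j ≤ S)
    (h1 : Summable fun j => a j * x j) (h2 : Summable fun j => a j * x j ^ 2) :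
    (∑' j, a j * x j) ^ 2 ≤ S * ∑' j, a j * x j ^ 2 := by
  set X := ∑' j, a j * x j with hX
  set Y := ∑' j, a j * x j ^ 2 with hY
  set S' := ∑' j, a j with hS'
  have hS'0 : 0 ≤ S' := tsum_nonneg ha
  have hY0 : 0 ≤ Y := tsum_nonneg fun j => mul_nonneg (ha j) (sq_nonneg _)
  have key : ∀ t : ℝ, 0 ≤ S' * (t * t) + (-(2 * X)) * t + Y := fun t => by
    have h : HasSum (fun j => a j * (t - x j) ^ 2) (t ^ 2 * S' - 2 * t * X + Y) := by
      have := ((hs.hasSum.mul_left (t ^ 2)).sub (h1.hasSum.mul_left (2 * t))).add h2.hasSum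
      refine this.congr_fun fun j => ?_
      ring
    have := h.nonneg fun j => mul_nonneg (ha j) (sq_nonneg _)
    linarith
  have hd := discrim_le_zero key
  rw [discrim] at hd
  have : X ^ 2 ≤ S' * Y := by nlinarith
  exact this.trans (mul_le_mul_of_nonneg_right hS hY0)

/-- **Schur's test**: a kernel dominated by a symmetric kernel with bounded row sums defines
a bounded operator on `ℓ²`. -/
theorem exists_schur_operator (K : ι → ι → ℂ) (a : ι → ι → ℝ) {S : ℝ}
    (hK : ∀ i j, ‖K i j‖ ≤ a i j) (hsymm : ∀ i j, a i j = a j i)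
    (hsum : ∀ i, Summable (a i)) (hS : ∀ i, ∑' j, a i j ≤ S) (hS0 : 0 ≤ S) :
    ∃ A : lp (fun _ : ι => ℂ) 2 →L[ℂ] lp (fun _ : ι => ℂ) 2,
      (∀ u i, HasSum (fun j => K i j * u j) (A u i)) ∧ ‖A‖ ≤ S := by
  have ha : ∀ i j, 0 ≤ a i j := fun i j => (norm_nonneg _).trans (hK i j)
  have hau : ∀ (u : lp (fun _ : ι => ℂ) 2) i, Summable fun j => a i j * ‖u j‖ := fun u i =>
    Summable.of_nonneg_of_le (fun j => mul_nonneg (ha i j) (norm_nonneg _))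
      (fun j => mul_le_mul_of_nonneg_left (lp.norm_apply_le_norm two_ne_zero u j) (ha i j))
      ((hsum i).mul_right ‖u‖)
  have hau2 : ∀ (u : lp (fun _ : ι => ℂ) 2) i, Summable fun j => a i j * ‖u j‖ ^ 2 := fun u i =>
    Summable.of_nonneg_of_le (fun j => mul_nonneg (ha i j) (sq_nonneg _))
      (fun j => mul_le_mul_of_nonneg_left (pow_le_pow_left₀ (norm_nonneg _)
        (lp.norm_apply_le_norm two_ne_zero u j) 2) (ha i j)) ((hsum i).mul_right (‖u‖ ^ 2))
  have hKn : ∀ (u : lp (fun _ : ι => ℂ) 2) i j, ‖K i j * u j‖ ≤ a i j * ‖u j‖ := fun u i j => by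
    rw [norm_mul]
    exact mul_le_mul_of_nonneg_right (hK i j) (norm_nonneg _)
  have hKu : ∀ (u : lp (fun _ : ι => ℂ) 2) i, Summable fun j => K i j * u j := fun u i =>
    Summable.of_norm_bounded (hau u i) (hKn u i)
  have hbound : ∀ (u : lp (fun _ : ι => ℂ) 2) (s : Finset ι),
      ∑ i ∈ s, ‖∑' j, K i j * u j‖ ^ 2 ≤ (S * ‖u‖) ^ 2 := by
    intro u s
    calc ∑ i ∈ s, ‖∑' j, K i j * u j‖ ^ 2
        ≤ ∑ i ∈ s, S * ∑' j, a i j * ‖u j‖ ^ 2 := by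
          refine Finset.sum_le_sum fun i _ => ?_
          refine le_trans (pow_le_pow_left₀ (norm_nonneg _)
            (tsum_of_norm_bounded (hau u i).hasSum (hKn u i)) 2) ?_
          exact sq_tsum_mul_le (ha i) (hsum i) (hS i) (hau u i) (hau2 u i)
      _ = S * ∑' j, (∑ i ∈ s, a i j) * ‖u j‖ ^ 2 := by
          rw [← Finset.mul_sum, ← Summable.tsum_finsetSum fun i _ => hau2 u i]
          simp_rw [Finset.sum_mul]
      -- After the sums are exchanged column sums appear; by symmetry of `a` they obey the row
      -- bound.
      _ ≤ S * ∑' j, S * ‖u j‖ ^ 2 := by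
          refine mul_le_mul_of_nonneg_left ?_ hS0
          have hle : ∀ j, (∑ i ∈ s, a i j) * ‖u j‖ ^ 2 ≤ S * ‖u j‖ ^ 2 := fun j => by
            refine mul_le_mul_of_nonneg_right ?_ (sq_nonneg _)
            simp_rw [fun i => hsymm i j]
            exact ((hsum j).sum_le_tsum s fun i _ => ha j i).trans (hS j)
          have hsumm := (lp_hasSum_norm_sq u).summable.mul_left S
          exact (Summable.of_nonneg_of_le (fun j => mul_nonneg
            (Finset.sum_nonneg fun i _ => ha i j) (sq_nonneg _)) hle hsumm).tsum_le_tsum hle hsumm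
      _ = (S * ‖u‖) ^ 2 := by
          rw [tsum_mul_left, (lp_hasSum_norm_sq u).tsum_eq]; ring
  have hmem : ∀ u : lp (fun _ : ι => ℂ) 2,
      Memℓp (fun i => ∑' j, K i j * u j) 2 := fun u =>
    memℓp_gen' (C := (S * ‖u‖) ^ 2) fun s => by simpa using hbound u s
  let L : lp (fun _ : ι => ℂ) 2 →ₗ[ℂ] lp (fun _ : ι => ℂ) 2 :=
    { toFun := fun u => ⟨fun i => ∑' j, K i j * u j, hmem u⟩
      map_add' := fun u v => by
        ext i
        simp only [lp.coeFn_add, Pi.add_apply, mul_add]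
        exact (hKu u i).tsum_add (hKu v i)
      map_smul' := fun c u => by
        ext i
        simp only [lp.coeFn_smul, Pi.smul_apply, smul_eq_mul, RingHom.id_apply]
        rw [← tsum_mul_left]
        exact tsum_congr fun j => by ring }
  have hLu : ∀ u i, L u i = ∑' j, K i j * u j := fun u i => rfl
  have hL : ∀ u, ‖L u‖ ≤ S * ‖u‖ := fun u => by
    refine lp.norm_le_of_forall_sum_le (by norm_num) (by positivity) fun s => ?_
    simpa [hLu] using hbound u s
  exact ⟨L.mkContinuous S hL, fun u i => (hKu u i).hasSum, L.mkContinuous_norm_le hS0 hL⟩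

theorem exists_diagonal_operator (r : ι → ℂ) {S : ℝ} (hS0 : 0 ≤ S) (hr : ∀ i, ‖r i‖ ≤ S) :
    ∃ R : lp (fun _ : ι => ℂ) 2 →L[ℂ] lp (fun _ : ι => ℂ) 2,
      (∀ u i, R u i = r i * u i) ∧ ‖R‖ ≤ S := by
  classical
  have hs : ∀ i : ι, HasSum (fun j => if i = j then S else 0) S := fun i => by
    have := hasSum_single (f := fun j => if i = j then S else 0) i fun j hj => if_neg hj.symm
    simpa using this
  obtain ⟨R, hR, hn⟩ := exists_schur_operator (fun i j => if i = j then r i else 0)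
    (fun i j => if i = j then S else 0) (S := S)
    (fun i j => by split_ifs <;> simp [hr]) (fun i j => by simp [eq_comm])
    (fun i => (hs i).summable) (fun i => (hs i).tsum_eq.le) hS0
  refine ⟨R, fun u i => (hR u i).unique ?_, hn⟩
  have := hasSum_single (f := fun j => (if i = j then r i else 0) * u j) i
    fun j hj => by simp [hj.symm]
  simpa using this

theorem im_conj_mul_ofReal_mul (x : ℂ) (d : ℝ) : ((starRingEnd ℂ) x * (d * x)).im = 0 := by
  simp only [Complex.mul_im, Complex.mul_re, Complex.conj_re, Complex.conj_im, Complex.ofReal_re,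
    Complex.ofReal_im]
  ring

/-- An a priori bound for a real diagonal matrix minus an operator with positive imaginary part. -/
theorem mul_norm_le_of_im_inner_ge {d : ι → ℝ}
    {A : lp (fun _ : ι => ℂ) 2 →L[ℂ] lp (fun _ : ι => ℂ) 2} {c : ℝ}
    {w f : lp (fun _ : ι => ℂ) 2} (hA : c * ‖w‖ ^ 2 ≤ (inner ℂ w (A w)).im)
    (h : ∀ i, (d i : ℂ) * w i - A w i = f i) : c * ‖w‖ ≤ ‖f‖ := by
  -- The vector f + A w has coordinates dᵢwᵢ, so its pairing with w is real term by term. It lies in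
  -- ℓ² even if d is unbounded, so no domain question arises.
  have h0 : (inner ℂ w (f + A w)).im = 0 := by
    have hs := (Complex.hasSum_iff _ _).1 (lp.hasSum_inner w (f + A w))
    refine hs.2.unique ?_
    convert! hasSum_zero using 1
    funext i
    have : (f + A w) i = (d i : ℂ) * w i := by
      rw [lp.coeFn_add, Pi.add_apply, ← h i]; ring
    rw [this, RCLike.inner_apply']
    exact im_conj_mul_ofReal_mul _ _
  rw [inner_add_right, Complex.add_im] at h0
  have h1 : -(inner ℂ w f).im ≤ ‖w‖ * ‖f‖ :=
    (neg_le_abs _).trans ((Complex.abs_im_le_norm _).trans (norm_inner_le_norm _ _))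
  rcases (norm_nonneg w).eq_or_lt with hw | hw
  · rw [← hw, mul_zero]; exact norm_nonneg f
  · refine le_of_mul_le_mul_left ?_ hw
    nlinarith

/-- A real diagonal matrix, possibly unbounded, minus a bounded operator with strictly positive
imaginary part has a bounded right inverse. -/
theorem exists_diagonal_sub_rightInverse (d : ι → ℝ)
    (A : lp (fun _ : ι => ℂ) 2 →L[ℂ] lp (fun _ : ι => ℂ) 2) {c : ℝ} (hc : 0 < c)
    (hA : ∀ w, c * ‖w‖ ^ 2 ≤ (inner ℂ w (A w)).im) :
    ∃ T : lp (fun _ : ι => ℂ) 2 →L[ℂ] lp (fun _ : ι => ℂ) 2,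
      ∀ v i, (d i : ℂ) * T v i - A (T v) i = v i := by
  -- Shift both parts by is: d - A = (d - is) - (A - is). The first has inverse R of norm at most
  -- 1/s. Coercivity gives ‖(A - is)u‖² ≤ (‖A‖² - 2sc + s²)‖u‖², and sc = ‖A‖² + 1 makes the bracket
  -- at most s² - 1. So R(A - is) is a strict contraction and a Neumann series applies.
  set s : ℝ := (‖A‖ ^ 2 + 1) / c with hs
  have hs0 : 0 < s := by positivity
  have hsc : s * c = ‖A‖ ^ 2 + 1 := by rw [hs]; field_simp
  have hden : ∀ i, s ≤ ‖(d i : ℂ) - s * Complex.I‖ := fun i => by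
    refine le_trans ?_ (Complex.abs_im_le_norm _)
    simp [abs_of_pos hs0]
  obtain ⟨R, hR, hRn⟩ := exists_diagonal_operator (fun i => ((d i : ℂ) - s * Complex.I)⁻¹)
    (S := s⁻¹) (by positivity) fun i => by
      rw [norm_inv]; exact inv_anti₀ hs0 (hden i)
  set B := A - ((s : ℂ) * Complex.I) • ContinuousLinearMap.id ℂ (lp (fun _ : ι => ℂ) 2) with hB
  have hBu : ∀ u, B u = A u - ((s : ℂ) * Complex.I) • u := fun u => by simp [hB]
  have hBn : ‖B‖ ≤ √(s ^ 2 - 1) := by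
    refine B.opNorm_le_bound (Real.sqrt_nonneg _) fun u => ?_
    have h1 : ‖B u‖ ^ 2 ≤ (s ^ 2 - 1) * ‖u‖ ^ 2 := by
      have e : RCLike.re (inner ℂ (A u) (((s : ℂ) * Complex.I) • u)) =
          s * (inner ℂ u (A u)).im := by
        have h2 : (inner ℂ (A u) u).im = -(inner ℂ u (A u)).im := by
          rw [← inner_conj_symm, Complex.conj_im]
        rw [inner_smul_right]
        simp [h2]
      have hAu : ‖A u‖ ^ 2 ≤ ‖A‖ ^ 2 * ‖u‖ ^ 2 := by
        rw [← mul_pow]; exact pow_le_pow_left₀ (norm_nonneg _) (A.le_opNorm u) 2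
      have hsu : ‖((s : ℂ) * Complex.I) • u‖ ^ 2 = s ^ 2 * ‖u‖ ^ 2 := by
        rw [norm_smul, norm_mul, Complex.norm_real, Complex.norm_I, mul_one,
          Real.norm_of_nonneg hs0.le, mul_pow]
      rw [hBu, norm_sub_sq (𝕜 := ℂ), e, hsu]
      have := mul_le_mul_of_nonneg_left (hA u) hs0.le
      rw [← mul_assoc, hsc] at this
      nlinarith [sq_nonneg ‖u‖, mul_nonneg (sq_nonneg ‖A‖) (sq_nonneg ‖u‖)]
    rw [← Real.sqrt_sq (norm_nonneg u), ← Real.sqrt_mul' _ (sq_nonneg _)]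
    exact Real.le_sqrt_of_sq_le h1
  have hlt : √(s ^ 2 - 1) < s := by
    rw [Real.sqrt_lt' hs0]; linarith
  have hE : ‖R.comp B‖ < 1 := by
    refine (R.opNorm_comp_le B).trans_lt ?_
    calc ‖R‖ * ‖B‖ ≤ s⁻¹ * √(s ^ 2 - 1) := by gcongr
      _ < s⁻¹ * s := by gcongr
      _ = 1 := inv_mul_cancel₀ hs0.ne'
  obtain ⟨U, hU⟩ := isUnit_one_sub_of_norm_lt_one hE
  refine ⟨(↑U⁻¹ : lp (fun _ : ι => ℂ) 2 →L[ℂ] lp (fun _ : ι => ℂ) 2).comp R, fun v i => ?_⟩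
  set u := ((↑U⁻¹ : lp (fun _ : ι => ℂ) 2 →L[ℂ] lp (fun _ : ι => ℂ) 2).comp R) v with hu
  have h1 : u - R (B u) = R v := by
    have := congrArg (fun F : lp (fun _ : ι => ℂ) 2 →L[ℂ] lp (fun _ : ι => ℂ) 2 => F (R v))
      U.mul_inv
    rw [hU] at this
    exact this
  have h2 := congrArg (fun x : lp (fun _ : ι => ℂ) 2 => x i) h1
  simp only [lp.coeFn_sub, Pi.sub_apply, hR, hBu, lp.coeFn_smul, Pi.smul_apply, smul_eq_mul] at h2
  have hne : (d i : ℂ) - s * Complex.I ≠ 0 := norm_pos_iff.1 (hs0.trans_le (hden i))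
  rw [sub_eq_iff_eq_add] at h2
  have h3 := congrArg (fun x => ((d i : ℂ) - s * Complex.I) * x) h2
  simp only [mul_add, mul_inv_cancel_left₀ hne] at h3
  linear_combination h3

end Operators

/-! ### The free Green's function and exponential sums over the lattice -/

/-- The argument of z lies in (0, π) and is halved. The imaginary part of the root drives decay; the
real part is what makes the spectral density positive. -/
theorem principalSqrt_re_im_pos {z : ℂ} (hz : 0 < z.im) :
    0 < (principalSqrt z).re ∧ 0 < (principalSqrt z).im := by
  have h0 : z ≠ 0 := by rintro rfl; simp at hz
  have ha : 0 < z.arg := by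
    refine lt_of_le_of_ne (Complex.arg_nonneg_iff.2 hz.le) fun h => ?_
    exact hz.ne (Complex.arg_eq_zero_iff.1 h.symm).2.symm
  have hb : z.arg < Real.pi := by
    refine lt_of_le_of_ne (Complex.arg_le_pi z) fun h => ?_
    exact hz.ne (Complex.arg_eq_pi_iff.1 h).2.symm
  rw [principalSqrt, Complex.cpow_def_of_ne_zero h0, Complex.exp_re, Complex.exp_im]
  have e : (Complex.log z * (1 / 2)).im = z.arg / 2 := by
    simp [Complex.mul_im, Complex.log_im, div_eq_mul_inv]
  rw [e]
  constructor
  · exact mul_pos (Real.exp_pos _) (Real.cos_pos_of_mem_Ioo ⟨by linarith, by linarith⟩)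
  · exact mul_pos (Real.exp_pos _) (Real.sin_pos_of_pos_of_lt_pi (by linarith) (by linarith))

theorem freeGreen_eq (z : ℂ) (x y : R3) :
    freeGreen z x y = sphericalWave (principalSqrt z) ‖x - y‖ / (4 * Real.pi) := by
  rw [freeGreen, sphericalWave]; ring

theorem norm_freeGreen (z : ℂ) (x y : R3) :
    ‖freeGreen z x y‖ =
      Real.exp (-(principalSqrt z).im * ‖x - y‖) / (4 * Real.pi * ‖x - y‖) := by
  rw [freeGreen_eq, norm_div, norm_sphericalWave _ (norm_nonneg _), norm_mul, Complex.norm_real,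
    Real.norm_of_nonneg Real.pi_pos.le]
  simp only [Complex.norm_ofNat]
  rw [div_div, mul_comm ‖x - y‖]

theorem freeGreen_comm (z : ℂ) (x y : R3) : freeGreen z x y = freeGreen z y x := by
  rw [freeGreen_eq, freeGreen_eq, norm_sub_rev]

theorem abs_le_norm_pt (m : Z3) (i : Fin 3) : |(m i : ℝ)| ≤ ‖pt m‖ :=
  PiLp.norm_apply_le (pt m) i

theorem one_le_norm_pt {m : Z3} (hm : m ≠ 0) : 1 ≤ ‖pt m‖ := by
  obtain ⟨i, hi⟩ := Function.ne_iff.1 hm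
  refine le_trans ?_ (abs_le_norm_pt m i)
  have : (1 : ℤ) ≤ |m i| := Int.one_le_abs hi
  exact_mod_cast this

theorem summable_exp_neg_abs {β : ℝ} (hβ : 0 < β) :
    Summable fun n : ℤ => Real.exp (-β * |(n : ℝ)|) := by
  have h : Summable fun n : ℕ => Real.exp (-β * n) := by
    simpa [mul_comm] using Real.summable_exp_nat_mul_iff.2 (neg_neg_of_pos hβ)
  refine Summable.of_nat_of_neg ?_ ?_ <;> simpa using h

/-- Since ‖m‖ dominates the mean of the |mᵢ|, the sum is controlled by a product of three
one-dimensional geometric sums. -/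
theorem summable_exp_neg_norm_pt {β : ℝ} (hβ : 0 < β) :
    Summable fun m : Z3 => Real.exp (-β * ‖pt m‖) := by
  set f : ℤ → ℝ := fun n => Real.exp (-(β / 3) * |(n : ℝ)|) with hf
  have h1 : Summable f := summable_exp_neg_abs (by positivity)
  have hf0 : 0 ≤ f := fun n => (Real.exp_pos _).le
  have h2 : Summable fun p : ℤ × ℤ × ℤ => f p.1 * (f p.2.1 * f p.2.2) :=
    h1.mul_of_nonneg (h1.mul_of_nonneg h1 hf0 hf0) hf0 fun p => mul_nonneg (hf0 _) (hf0 _)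
  have hinj : Function.Injective fun m : Z3 => (m 0, m 1, m 2) := fun m n h => by
    simp only [Prod.mk.injEq] at h
    funext i
    fin_cases i <;> simp [h]
  refine Summable.of_nonneg_of_le (fun m => (Real.exp_pos _).le) (fun m => ?_)
    (h2.comp_injective hinj)
  simp only [Function.comp_apply, hf, ← Real.exp_add]
  refine Real.exp_le_exp.2 ?_
  nlinarith [abs_le_norm_pt m 0, abs_le_norm_pt m 1, abs_le_norm_pt m 2]

/-- The lattice sum `∑ exp (-β ‖m‖)` over `ℤ³`. -/
noncomputable def latticeSum (β : ℝ) : ℝ := ∑' m : Z3, Real.exp (-β * ‖pt m‖)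

theorem latticeSum_pos {β : ℝ} (hβ : 0 < β) : 0 < latticeSum β :=
  (summable_exp_neg_norm_pt hβ).tsum_pos (fun _ => (Real.exp_pos _).le) 0 (Real.exp_pos _)

theorem exists_norm_sub_pt_le_one (x : R3) : ∃ n : Z3, ‖x - pt n‖ ≤ 1 := by
  refine ⟨fun i => round (x i), ?_⟩
  have h : ∀ i, (x i - round (x i)) ^ 2 ≤ 1 / 4 := fun i => by
    have := abs_sub_round (x i)
    rw [← sq_abs]
    nlinarith [abs_nonneg (x i - round (x i))]
  have hs : ‖x - pt fun i => round (x i)‖ ^ 2 ≤ 1 := by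
    rw [EuclideanSpace.real_norm_sq_eq, Fin.sum_univ_three]
    simp only [PiLp.sub_apply, pt]
    linarith [h 0, h 1, h 2]
  exact (sq_le_one_iff₀ (norm_nonneg _)).1 hs

section Sites

variable (s : Set Z3)

/-- The bound is the sum over the whole lattice, whatever the set of sites; this keeps later
constants independent of ω. -/
theorem summable_sites {β : ℝ} (hβ : 0 < β) (i : Z3) :
    (Summable fun j : s => Real.exp (-β * ‖pt i - pt j‖)) ∧
      ∑' j : s, Real.exp (-β * ‖pt i - pt j‖) ≤ latticeSum β := by
  have hinj : Function.Injective fun j : s => i - (j : Z3) := fun j k h =>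
    Subtype.ext (sub_right_injective h)
  have hs := summable_exp_neg_norm_pt hβ
  have hc := hs.comp_injective hinj
  simp only [Function.comp_def, pt_sub] at hc
  refine ⟨hc, ?_⟩
  have := tsum_comp_le_tsum_of_inj hs (fun _ => (Real.exp_pos _).le) hinj
  simpa only [Function.comp_def, pt_sub, latticeSum] using this

theorem summable_sites_of_point {β : ℝ} (hβ : 0 < β) (x : R3) :
    (Summable fun j : s => Real.exp (-β * ‖x - pt j‖)) ∧
      ∑' j : s, Real.exp (-β * ‖x - pt j‖) ≤ Real.exp β * latticeSum β := by
  obtain ⟨n, hn⟩ := exists_norm_sub_pt_le_one x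
  obtain ⟨h1, h2⟩ := summable_sites s hβ n
  have hle : ∀ j : s, Real.exp (-β * ‖x - pt j‖) ≤
      Real.exp β * Real.exp (-β * ‖pt n - pt j‖) := fun j => by
    rw [← Real.exp_add]
    refine Real.exp_le_exp.2 ?_
    have : ‖pt n - pt j‖ ≤ ‖pt n - x‖ + ‖x - pt j‖ := norm_sub_le_norm_sub_add_norm_sub _ _ _
    rw [norm_sub_rev (pt n) x] at this
    nlinarith
  have hs := Summable.of_nonneg_of_le (fun j => (Real.exp_pos _).le) hle (h1.mul_left _)
  refine ⟨hs, (hs.tsum_le_tsum hle (h1.mul_left _)).trans ?_⟩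
  rw [tsum_mul_left]
  exact mul_le_mul_of_nonneg_left h2 (Real.exp_pos _).le

end Sites

/-! ### The regularized Green's kernel: coercivity and exponential weights -/

open Classical in
/-- The bounded part of `-Γ(z, ω)`, the matrix of the regularized free Green's function. -/
noncomputable def greenKernel (z : ℂ) (i j : Z3) : ℂ :=
  if i = j then Complex.I * (principalSqrt z / (4 * Real.pi)) else freeGreen z (pt i) (pt j)

theorem greenKernel_comm (z : ℂ) (i j : Z3) : greenKernel z i j = greenKernel z j i := by
  unfold greenKernel
  by_cases h : i = j
  · rw [h]
  · rw [if_neg h, if_neg (Ne.symm h), freeGreen_comm]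

theorem greenKernel_im {z : ℂ} (hz : 0 < z.im) (i j : Z3) :
    (greenKernel z i j).im = imGreen (principalSqrt z) (pt i - pt j) := by
  unfold greenKernel
  split_ifs with h
  · have e : (4 * (Real.pi : ℂ)) = ((4 * Real.pi : ℝ) : ℂ) := by push_cast; rfl
    rw [h, sub_self, imGreen_zero, Complex.I_mul_im, e, Complex.div_ofReal_re]
  · have hne : pt i - pt j ≠ 0 := by
      rw [← pt_sub, ← norm_pos_iff]
      exact one_pos.trans_le (one_le_norm_pt (sub_ne_zero.2 h))
    rw [imGreen_eq_im (principalSqrt_re_im_pos hz).1.ne' hne, freeGreen_eq]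

theorem norm_greenKernel_le (z : ℂ) (i j : Z3) :
    ‖greenKernel z i j‖ ≤
      (‖principalSqrt z‖ + 1) * Real.exp (-(principalSqrt z).im * ‖pt i - pt j‖) := by
  have hpi : (1 : ℝ) ≤ 4 * Real.pi := by linarith [Real.pi_gt_three]
  unfold greenKernel
  split_ifs with h
  · rw [h, sub_self, norm_zero, mul_zero, Real.exp_zero, mul_one, norm_mul, Complex.norm_I, one_mul,
      norm_div, norm_mul, Complex.norm_real, Real.norm_of_nonneg Real.pi_pos.le,
      Complex.norm_ofNat]
    exact (div_le_self (norm_nonneg _) hpi).trans (by linarith)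
  · have hne : 1 ≤ ‖pt i - pt j‖ := by
      rw [← pt_sub]; exact one_le_norm_pt (sub_ne_zero.2 h)
    rw [norm_freeGreen]
    refine (div_le_self (Real.exp_pos _).le (one_le_mul_of_one_le_of_one_le hpi hne)).trans ?_
    exact le_mul_of_one_le_left (Real.exp_pos _).le (by linarith [norm_nonneg (principalSqrt z)])

/-- The imaginary part of conj(uᵢ)uⱼ is antisymmetric in i, j, so it cancels against the symmetric
real part of K. -/
theorem im_double_sum_symm {α : Type*} (s : Finset α) (u : α → ℂ) (K : α → α → ℂ)
    (hK : ∀ i j, K i j = K j i) :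
    (∑ i ∈ s, ∑ j ∈ s, (starRingEnd ℂ) (u i) * u j * K i j).im =
      (∑ i ∈ s, ∑ j ∈ s, (starRingEnd ℂ) (u i) * u j * ((K i j).im : ℂ)).re := by
  have h0 : ∑ i ∈ s, ∑ j ∈ s, ((starRingEnd ℂ) (u i) * u j).im * (K i j).re = 0 := by
    have h : ∑ i ∈ s, ∑ j ∈ s, ((starRingEnd ℂ) (u i) * u j).im * (K i j).re =
        -∑ i ∈ s, ∑ j ∈ s, ((starRingEnd ℂ) (u i) * u j).im * (K i j).re := by
      conv_lhs => rw [Finset.sum_comm]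
      rw [← Finset.sum_neg_distrib]
      refine Finset.sum_congr rfl fun i _ => ?_
      rw [← Finset.sum_neg_distrib]
      refine Finset.sum_congr rfl fun j _ => ?_
      rw [hK j i]
      simp only [Complex.mul_im, Complex.conj_re, Complex.conj_im]
      ring
    linarith
  simp only [Complex.im_sum, Complex.re_sum]
  rw [← sub_eq_zero, ← h0, ← Finset.sum_sub_distrib]
  refine Finset.sum_congr rfl fun i _ => ?_
  rw [← Finset.sum_sub_distrib]
  refine Finset.sum_congr rfl fun j _ => ?_
  rw [Complex.mul_im, Complex.re_mul_ofReal]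
  ring

/-- The operator of a symmetric kernel inherits lower bounds on its finite sections. -/
theorem im_inner_ge_of_finite {ι : Type*} {K : ι → ι → ℂ} (hK : ∀ i j, K i j = K j i)
    {A : lp (fun _ : ι => ℂ) 2 →L[ℂ] lp (fun _ : ι => ℂ) 2}
    (hA : ∀ u i, HasSum (fun j => K i j * u j) (A u i)) {c : ℝ}
    (hc : ∀ (s : Finset ι) (u : ι → ℂ), c * ∑ j ∈ s, ‖u j‖ ^ 2 ≤
      (∑ i ∈ s, ∑ j ∈ s, (starRingEnd ℂ) (u i) * u j * ((K i j).im : ℂ)).re)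
    (w : lp (fun _ : ι => ℂ) 2) : c * ‖w‖ ^ 2 ≤ (inner ℂ w (A w)).im := by
  classical
  have hcont : Continuous fun w : lp (fun _ : ι => ℂ) 2 => (inner ℂ w (A w)).im :=
    Complex.continuous_im.comp (continuous_id.inner A.continuous)
  have hlim : Filter.Tendsto (fun s : Finset ι => ∑ i ∈ s, lp.single 2 i (w i)) Filter.atTop
    (nhds w) := lp.hasSum_single (by norm_num) w
  have hcont' : Continuous fun w : lp (fun _ : ι => ℂ) 2 => c * ‖w‖ ^ 2 :=
    continuous_const.mul (continuous_norm.pow 2)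
  -- Finitely supported vectors are dense and both sides are continuous in w.
  refine le_of_tendsto_of_tendsto' ((hcont'.tendsto w).comp hlim) ((hcont.tendsto w).comp hlim)
    fun s => ?_
  simp only [Function.comp_apply]
  set v : lp (fun _ : ι => ℂ) 2 := ∑ i ∈ s, lp.single 2 i (w i) with hv
  have hvi : ∀ i, v i = if i ∈ s then w i else 0 := fun i => by
    rw [hv, lp.coeFn_sum, Finset.sum_apply]
    simp [Pi.single_apply]
  have hAv : ∀ i, A v i = ∑ j ∈ s, K i j * w j := fun i => by
    refine (hA v i).unique ?_
    have : HasSum (fun j => K i j * v j) (∑ j ∈ s, K i j * v j) :=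
      hasSum_sum_of_ne_finset_zero fun j hj => by rw [hvi, if_neg hj, mul_zero]
    rwa [Finset.sum_congr rfl fun j hj => by rw [hvi, if_pos hj]] at this
  have hin : inner ℂ v (A v) = ∑ i ∈ s, ∑ j ∈ s, (starRingEnd ℂ) (w i) * w j * K i j := by
    refine (lp.hasSum_inner v (A v)).unique ?_
    have : HasSum (fun i => inner ℂ (v i) (A v i)) (∑ i ∈ s, inner ℂ (v i) (A v i)) :=
      hasSum_sum_of_ne_finset_zero fun j hj => by rw [hvi, if_neg hj, inner_zero_left]
    convert! this using 1
    refine Finset.sum_congr rfl fun i hi => ?_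
    rw [hvi, if_pos hi, hAv, RCLike.inner_apply', Finset.mul_sum]
    exact Finset.sum_congr rfl fun j _ => by ring
  have hn : ‖v‖ ^ 2 = ∑ j ∈ s, ‖w j‖ ^ 2 := by
    refine (lp_hasSum_norm_sq v).unique ?_
    have : HasSum (fun i => ‖v i‖ ^ 2) (∑ i ∈ s, ‖v i‖ ^ 2) :=
      hasSum_sum_of_ne_finset_zero fun j hj => by
        rw [hvi, if_neg hj, norm_zero, zero_pow two_ne_zero]
    rwa [Finset.sum_congr rfl fun j hj => by rw [hvi, if_pos hj]] at this
  rw [hin, hn, im_double_sum_symm s w K hK]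
  exact hc s w

/-- Coercivity of the imaginary part of the regularized Green's kernel on any set of sites. -/
theorem greenKernel_coercive {z : ℂ} (hz : 0 < z.im) :
    ∃ c : ℝ, 0 < c ∧ ∀ (Λ : Set Z3) (A : lp (fun _ : Λ => ℂ) 2 →L[ℂ] lp (fun _ : Λ => ℂ) 2),
      (∀ u (i : Λ), HasSum (fun j : Λ => greenKernel z i j * u j) (A u i)) →
      ∀ w, c * ‖w‖ ^ 2 ≤ (inner ℂ w (A w)).im := by
  classical
  obtain ⟨hre, him⟩ := principalSqrt_re_im_pos hz
  obtain ⟨c, hc, h⟩ := imGreen_form_lower_bound hre him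
  refine ⟨c, hc, fun Λ A hA w => im_inner_ge_of_finite (K := fun i j : Λ => greenKernel z i j)
    (fun i j => greenKernel_comm z i j) hA (fun s u => ?_) w⟩
  -- Extension by zero to the lattice transfers the bound to any set of sites with the same
  -- constant.
  have := h (s.map (Function.Embedding.subtype _)) fun m => if hm : m ∈ Λ then u ⟨m, hm⟩ else 0
  simpa [greenKernel_im hz] using this

theorem exists_greenOperator {z : ℂ} (hz : 0 < z.im) (Λ : Set Z3) :
    ∃ A : lp (fun _ : Λ => ℂ) 2 →L[ℂ] lp (fun _ : Λ => ℂ) 2,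
      ∀ u (i : Λ), HasSum (fun j : Λ => greenKernel z i j * u j) (A u i) := by
  obtain ⟨-, him⟩ := principalSqrt_re_im_pos hz
  obtain ⟨A, hA, -⟩ := exists_schur_operator (fun i j : Λ => greenKernel z i j)
    (fun i j : Λ => (‖principalSqrt z‖ + 1) *
      Real.exp (-(principalSqrt z).im * ‖pt i - pt j‖))
    (S := (‖principalSqrt z‖ + 1) * latticeSum (principalSqrt z).im)
    (fun i j => norm_greenKernel_le z i j) (fun i j => by rw [norm_sub_rev])
    (fun i => (summable_sites Λ him i).1.mul_left _)
    (fun i => by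
      rw [tsum_mul_left]
      exact mul_le_mul_of_nonneg_left (summable_sites Λ him i).2 (by positivity))
    (mul_nonneg (by positivity) (latticeSum_pos him).le)
  exact ⟨A, hA⟩

theorem abs_exp_sub_one_le (t : ℝ) : |Real.exp t - 1| ≤ |t| * Real.exp |t| := by
  rw [abs_le]
  constructor
  · have h1 := Real.add_one_le_exp t
    have h2 : |t| * 1 ≤ |t| * Real.exp |t| :=
      mul_le_mul_of_nonneg_left (Real.one_le_exp (abs_nonneg t)) (abs_nonneg t)
    linarith [neg_abs_le t]
  · have h1 := Real.add_one_le_exp (-t)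
    have h2 : Real.exp t * Real.exp (-t) = 1 := by rw [← Real.exp_add]; simp
    have h3 : Real.exp t - 1 ≤ t * Real.exp t := by nlinarith [Real.exp_pos t]
    refine h3.trans ?_
    exact (mul_le_mul_of_nonneg_right (le_abs_self t) (Real.exp_pos t).le).trans
      (mul_le_mul_of_nonneg_left (Real.exp_le_exp.2 (le_abs_self t)) (abs_nonneg t))

/-- Conjugating the kernel by an exponential weight of small rate is a small perturbation. -/
theorem exists_weight_perturbation {z : ℂ} (hz : 0 < z.im) :
    ∃ M : ℝ, 0 < M ∧ ∀ γ : ℝ, 0 < γ → γ ≤ (principalSqrt z).im / 4 →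
      ∀ (Λ : Set Z3) (ρ : Λ → ℝ), (∀ i j : Λ, |ρ i - ρ j| ≤ ‖pt i - pt j‖) →
      ∃ D : lp (fun _ : Λ => ℂ) 2 →L[ℂ] lp (fun _ : Λ => ℂ) 2,
        (∀ u (i : Λ), HasSum (fun j : Λ =>
          (Real.exp (γ * (ρ i - ρ j)) - 1 : ℝ) * greenKernel z i j * u j) (D u i)) ∧
        ‖D‖ ≤ γ * M := by
  obtain ⟨-, him⟩ := principalSqrt_re_im_pos hz
  set b := (principalSqrt z).im with hb
  set N := ‖principalSqrt z‖ + 1 with hN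
  have hN0 : 0 < N := by positivity
  have hb2 : 0 < b / 2 := by positivity
  have hL := latticeSum_pos hb2
  -- Out of the decay rate b of the kernel, b/4 pays for exp(γr) and b/4 for the linear factor,
  -- through r ≤ (4/b)exp(br/4); the rate b/2 is left for the row sums.
  refine ⟨4 / b * N * latticeSum (b / 2), by positivity, fun γ hγ hγb Λ ρ hρ => ?_⟩
  refine exists_schur_operator
    (fun i j : Λ => (Real.exp (γ * (ρ i - ρ j)) - 1 : ℝ) * greenKernel z i j)
    (fun i j : Λ => γ * (4 / b) * N * Real.exp (-(b / 2) * ‖pt i - pt j‖))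
    (fun i j => ?_) (fun i j => by rw [norm_sub_rev])
    (fun i => (summable_sites Λ hb2 i).1.mul_left _) (fun i => ?_) (by positivity)
  · set r := ‖pt i - pt j‖ with hr
    have hr0 : 0 ≤ r := norm_nonneg _
    have ht : |γ * (ρ i - ρ j)| ≤ γ * r := by
      rw [abs_mul, abs_of_pos hγ]; exact mul_le_mul_of_nonneg_left (hρ i j) hγ.le
    have h1 : |Real.exp (γ * (ρ i - ρ j)) - 1| ≤ γ * r * Real.exp (γ * r) :=
      (abs_exp_sub_one_le _).trans
        (mul_le_mul ht (Real.exp_le_exp.2 ht) (Real.exp_pos _).le (by positivity))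
    have h2 : r ≤ 4 / b * Real.exp (b / 4 * r) := by
      have := Real.add_one_le_exp (b / 4 * r)
      calc r = 4 / b * (b / 4 * r) := by field_simp
        _ ≤ _ := mul_le_mul_of_nonneg_left (by linarith) (by positivity)
    have h3 : Real.exp (γ * r) ≤ Real.exp (b / 4 * r) :=
      Real.exp_le_exp.2 (mul_le_mul_of_nonneg_right hγb hr0)
    rw [norm_mul, Complex.norm_real, Real.norm_eq_abs]
    calc |Real.exp (γ * (ρ i - ρ j)) - 1| * ‖greenKernel z i j‖
        ≤ (γ * (4 / b * Real.exp (b / 4 * r)) * Real.exp (b / 4 * r)) *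
            (N * Real.exp (-b * r)) := by
          refine mul_le_mul (h1.trans ?_) (norm_greenKernel_le z i j) (norm_nonneg _)
            (by positivity)
          gcongr
      _ = γ * (4 / b) * N * (Real.exp (b / 4 * r) * Real.exp (b / 4 * r) * Real.exp (-b * r)) := by
          ring
      _ = _ := by
          rw [← Real.exp_add, ← Real.exp_add]
          ring_nf
  · rw [tsum_mul_left]
    calc _ ≤ γ * (4 / b) * N * latticeSum (b / 2) :=
          mul_le_mul_of_nonneg_left (summable_sites Λ hb2 i).2 (by positivity)
      _ = _ := by ring

/-! ### The inverse of Γ and the decay of its entries -/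

theorem hasSum_gammaMatrix {z : ℂ} {ω : Z3 → ℝ} {A : ell2 ω →L[ℂ] ell2 ω}
    (hA : ∀ u (i : activeSites ω),
      HasSum (fun j : activeSites ω => greenKernel z i j * u j) (A u i))
    (u : ell2 ω) (i : activeSites ω) :
    HasSum (fun j : activeSites ω => gammaMatrix z ω i j * u j)
      (((1 / ω i : ℝ) : ℂ) * u i - A u i) := by
  classical
  have h1 : HasSum (fun j : activeSites ω => (if i = j then ((1 / ω i : ℝ) : ℂ) else 0) * u j)
      (((1 / ω i : ℝ) : ℂ) * u i) := by
    have := hasSum_single (f := fun j : activeSites ω =>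
      (if i = j then ((1 / ω i : ℝ) : ℂ) else 0) * u j) i fun j hj => by simp [hj.symm]
    simpa using this
  refine (h1.sub (hA u i)).congr_fun fun j => ?_
  rw [← sub_mul]
  congr 1
  by_cases h : i = j
  · subst h
    simp [gammaMatrix, greenKernel]
  · have h' : (i : Z3) ≠ j := fun e => h (Subtype.ext e)
    simp [gammaMatrix, greenKernel, h, h']

/-- **Combes–Thomas estimate** for the inverse of `Γ(z, ω)`. -/
theorem exists_gammaInvEntry_bound {z : ℂ} (hz : 0 < z.im) :
    ∃ C γ : ℝ, 0 < C ∧ 0 < γ ∧ γ ≤ (principalSqrt z).im / 4 ∧ ∀ ω : Z3 → ℝ,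
      IsGammaInverse z ω (gammaInv z ω) ∧
      ∀ i j : activeSites ω, ‖gammaInvEntry z ω i j‖ ≤ C * Real.exp (-γ * ‖pt i - pt j‖) := by
  classical
  obtain ⟨-, him⟩ := principalSqrt_re_im_pos hz
  obtain ⟨c, hc, hcoer⟩ := greenKernel_coercive hz
  obtain ⟨M, hM, hpert⟩ := exists_weight_perturbation hz
  -- The first bound meets the requirement of the weight perturbation; the second makes the
  -- perturbation at most c/2, so half of the coercivity remains.
  set γ := min ((principalSqrt z).im / 4) (c / (2 * M)) with hγ
  have hγ0 : 0 < γ := lt_min (by positivity) (by positivity)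
  have hγM : γ * M ≤ c / 2 := by
    calc γ * M ≤ c / (2 * M) * M := mul_le_mul_of_nonneg_right (min_le_right _ _) hM.le
      _ = c / 2 := by field_simp
  refine ⟨2 / c, γ, by positivity, hγ0, min_le_left _ _, fun ω => ?_⟩
  obtain ⟨A, hA⟩ := exists_greenOperator hz (activeSites ω)
  have hAc := hcoer _ A hA
  have hΓ := hasSum_gammaMatrix (z := z) hA
  have hex : ∃ T, IsGammaInverse z ω T := by
    obtain ⟨T, hT⟩ := exists_diagonal_sub_rightInverse (fun i : activeSites ω => 1 / ω i) A hc hAc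
    refine ⟨T, fun v i => ?_, fun u v huv => ?_⟩
    · have := hΓ (T v) i
      rwa [hT v i] at this
    · have h0 : ∀ i : activeSites ω,
          ((1 / ω i : ℝ) : ℂ) * (T v - u) i - A (T v - u) i = (0 : ell2 ω) i := fun i => by
        have e := (hΓ u i).unique (huv i)
        have e' := hT v i
        rw [map_sub, lp.coeFn_sub, lp.coeFn_sub, Pi.sub_apply, Pi.sub_apply, lp.coeFn_zero,
          Pi.zero_apply]
        linear_combination e' - e
      have h1 := mul_norm_le_of_im_inner_ge (hAc _) h0
      rw [norm_zero] at h1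
      have h2 : ‖T v - u‖ ≤ 0 := by
        by_contra! hlt
        exact absurd h1 (not_le.2 (mul_pos hc hlt))
      exact sub_eq_zero.1 (norm_le_zero_iff.1 h2)
  have hinv : IsGammaInverse z ω (gammaInv z ω) := by
    rw [gammaInv, dif_pos hex]
    exact hex.choose_spec
  refine ⟨hinv, fun i j => ?_⟩
  set δ : ell2 ω := lp.single 2 j (1 : ℂ) with hδ
  set u := gammaInv z ω δ with hu
  -- The distance to j, truncated at ‖pt i - pt j‖: the weight is then a bounded operator, ρ is
  -- still 1-Lipschitz, vanishes at j and attains the full distance at i.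
  set ρ : activeSites ω → ℝ := fun l => min ‖pt l - pt j‖ ‖pt i - pt j‖ with hρ
  have hρL : ∀ l m : activeSites ω, |ρ l - ρ m| ≤ ‖pt l - pt m‖ := fun l m => by
    refine (abs_min_sub_min_le_max _ _ _ _).trans (max_le ?_ (by simp))
    refine (abs_norm_sub_norm_le _ _).trans_eq ?_
    rw [sub_sub_sub_cancel_right]
  obtain ⟨D, hD, hDn⟩ := hpert γ hγ0 (min_le_left _ _) (activeSites ω) ρ hρL
  obtain ⟨W, hW, -⟩ := exists_diagonal_operator (fun l => ((Real.exp (γ * ρ l) : ℝ) : ℂ))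
    (S := Real.exp (γ * ‖pt i - pt j‖)) (Real.exp_pos _).le fun l => by
      rw [Complex.norm_real, Real.norm_of_nonneg (Real.exp_pos _).le]
      exact Real.exp_le_exp.2 (mul_le_mul_of_nonneg_left (min_le_right _ _) hγ0.le)
  have hcoerD : ∀ w : ell2 ω, c / 2 * ‖w‖ ^ 2 ≤ (inner ℂ w ((A + D) w)).im := fun w => by
    have h1 : -(inner ℂ w (D w)).im ≤ γ * M * ‖w‖ ^ 2 := by
      refine (neg_le_abs _).trans ((Complex.abs_im_le_norm _).trans
        ((norm_inner_le_norm _ _).trans ?_))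
      have := (D.le_opNorm w).trans (mul_le_mul_of_nonneg_right hDn (norm_nonneg w))
      nlinarith [norm_nonneg w]
    have h2 := hAc w
    rw [add_apply, inner_add_right, Complex.add_im]
    nlinarith [mul_le_mul_of_nonneg_right hγM (sq_nonneg ‖w‖)]
  have heq : ∀ l : activeSites ω,
      ((1 / ω l : ℝ) : ℂ) * (W u) l - (A + D) (W u) l = δ l := fun l => by
    -- A + D is A conjugated by the weight W, while the diagonal commutes with W. Hence W u solves
    -- the perturbed equation with right-hand side Wδⱼ = δⱼ, the weight at j being 1.
    have hconj : (A + D) (W u) l = ((Real.exp (γ * ρ l) : ℝ) : ℂ) * A u l := by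
      rw [add_apply, lp.coeFn_add, Pi.add_apply]
      refine ((hA (W u) l).add (hD (W u) l)).unique
        (((hA u l).mul_left ((Real.exp (γ * ρ l) : ℝ) : ℂ)).congr_fun fun m => ?_)
      have he : Real.exp (γ * (ρ l - ρ m)) * Real.exp (γ * ρ m) = Real.exp (γ * ρ l) := by
        rw [← Real.exp_add]; ring_nf
      rw [hW, ← he]
      push_cast
      ring
    have hu' : ((1 / ω l : ℝ) : ℂ) * u l - A u l = δ l := (hΓ u l).unique (hinv.1 δ l)
    rw [hconj, hW, mul_left_comm, ← mul_sub, hu', hδ, lp.single_apply]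
    by_cases h : l = j
    · subst h
      have : ρ l = 0 := by simp [hρ]
      simp [this]
    · simp [Pi.single_eq_of_ne h]
  have hbound := mul_norm_le_of_im_inner_ge (hcoerD (W u)) heq
  rw [hδ, lp.norm_single (by norm_num), norm_one] at hbound
  have hi : Real.exp (γ * ‖pt i - pt j‖) * ‖u i‖ ≤ ‖W u‖ := by
    refine le_trans (le_of_eq ?_) (lp.norm_apply_le_norm two_ne_zero (W u) i)
    rw [hW, norm_mul, Complex.norm_real, Real.norm_of_nonneg (Real.exp_pos _).le]
    simp [hρ]
  have hent : gammaInvEntry z ω i j = u i := by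
    rw [gammaInvEntry, hu, hδ]
  rw [hent, neg_mul, Real.exp_neg, ← div_eq_mul_inv, le_div_iff₀ (Real.exp_pos _), mul_comm]
  refine hi.trans ?_
  rw [le_div_iff₀ hc]
  linarith

/-! ### Distances to the lattice, the unit cube and the Coulomb singularity -/

theorem isClosed_latticeSet : IsClosed latticeSet := by
  have h : latticeSet = ⋂ i : Fin 3, {x : R3 | x i ∈ Set.range ((↑) : ℤ → ℝ)} := by
    ext x
    simp only [latticeSet, Set.mem_range, Set.mem_iInter, Set.mem_ofPred_eq]
    constructor
    · rintro ⟨m, rfl⟩ i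
      exact ⟨m i, rfl⟩
    · intro hx
      choose m hm using hx
      exact ⟨m, PiLp.ext hm⟩
  rw [h]
  refine isClosed_iInter fun i => ?_
  exact Int.isClosedEmbedding_coe_real.isClosed_range.preimage (by fun_prop)

theorem latticeDist_pos {x : R3} (hx : x ∉ latticeSet) : 0 < latticeDist x :=
  (isClosed_latticeSet.notMem_iff_infDist_pos (Set.range_nonempty pt)).1 hx

theorem latticeDist_le (x : R3) (i : Z3) : latticeDist x ≤ ‖x - pt i‖ := by
  rw [← dist_eq_norm]
  exact Metric.infDist_le_dist_of_mem ⟨i, rfl⟩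

theorem latticeDist_le_one (x : R3) : latticeDist x ≤ 1 := by
  obtain ⟨n, hn⟩ := exists_norm_sub_pt_le_one x
  exact (latticeDist_le x n).trans hn

theorem norm_le_of_mem_unitCube {x : R3} (hx : x ∈ unitCube) : ‖x‖ ≤ 1 := by
  have h : ∀ i, x i ^ 2 ≤ 1 / 4 := fun i => by
    rw [← sq_abs]
    have := hx i
    nlinarith [abs_nonneg (x i)]
  refine (sq_le_one_iff₀ (norm_nonneg _)).1 ?_
  rw [EuclideanSpace.real_norm_sq_eq, Fin.sum_univ_three]
  linarith [h 0, h 1, h 2]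

/-- The origin is a nearest lattice point of each point of the unit cube. -/
theorem norm_le_norm_add_pt {x : R3} (hx : x ∈ unitCube) (m i : Z3) :
    ‖x‖ ≤ ‖x + pt m - pt i‖ := by
  rw [add_sub_assoc, ← pt_sub]
  refine (sq_le_sq₀ (norm_nonneg _) (norm_nonneg _)).1 ?_
  rw [EuclideanSpace.real_norm_sq_eq, EuclideanSpace.real_norm_sq_eq]
  refine Finset.sum_le_sum fun l _ => ?_
  rw [PiLp.add_apply]
  refine sq_le_sq.2 ?_
  have hl := hx l
  change |x l| ≤ |x l + ((m - i) l : ℝ)|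
  rcases eq_or_ne ((m - i) l) 0 with h | h
  · rw [h]; simp
  · have h1 : (1 : ℝ) ≤ |((m - i) l : ℝ)| := by exact_mod_cast Int.one_le_abs h
    have h2 := abs_sub_abs_le_abs_sub ((m - i) l : ℝ) (-x l)
    rw [abs_neg, sub_neg_eq_add, add_comm _ (x l)] at h2
    linarith

theorem isClosed_unitCube : IsClosed unitCube := by
  have h : unitCube = ⋂ i : Fin 3, {x : R3 | |x i| ≤ 1 / 2} := by
    ext x; simp [unitCube]
  rw [h]
  exact isClosed_iInter fun i => isClosed_le (by fun_prop) continuous_const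

theorem volume_unitCube_lt_top : volume unitCube < ⊤ :=
  (measure_mono fun x hx => by
    simpa using norm_le_of_mem_unitCube hx :
      volume unitCube ≤ volume (Metric.closedBall (0 : R3) 1)).trans_lt
    measure_closedBall_lt_top

instance isFiniteMeasure_restrict_unitCube : IsFiniteMeasure (volume.restrict unitCube) :=
  ⟨by simpa using volume_unitCube_lt_top⟩

/-- The Coulomb kernel is integrable on the cube, uniformly in the position of the pole. -/
theorem exists_integral_inv_norm_bound :
    ∃ K : ℝ, 0 ≤ K ∧ ∀ a : R3, Integrable (fun x => ‖x - a‖⁻¹) (volume.restrict unitCube) ∧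
      ∫ x in unitCube, ‖x - a‖⁻¹ ≤ K := by
  -- The function g(x) = exp(1 - ‖x‖)/‖x‖ dominates 1/‖x‖ in the unit ball, and the constant 1 does
  -- so outside. It is integrable on all of space, so translation invariance gives a bound
  -- independent of the pole.
  set g : R3 → ℝ := fun x => Real.exp 1 * ‖sphericalWave Complex.I ‖x‖‖ with hg
  have hgi : Integrable g :=
    (integrable_sphericalWave (κ := Complex.I) (by simp)).norm.const_mul _
  have hg0 : ∀ x, 0 ≤ g x := fun x => by positivity
  have hle : ∀ x : R3, ‖x‖⁻¹ ≤ 1 + g x := fun x => by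
    have hx := norm_nonneg x
    simp only [hg, norm_sphericalWave _ hx, Complex.I_im]
    rcases le_total ‖x‖ 1 with h | h
    · have h1 : 1 ≤ Real.exp 1 * Real.exp (-1 * ‖x‖) := by
        rw [← Real.exp_add]; exact Real.one_le_exp (by linarith)
      rw [← mul_div_assoc, inv_eq_one_div]
      exact (div_le_div_of_nonneg_right h1 hx).trans (by linarith)
    · have h1 : ‖x‖⁻¹ ≤ 1 := inv_le_one_of_one_le₀ h
      have : 0 ≤ Real.exp 1 * (Real.exp (-1 * ‖x‖) / ‖x‖) := by positivity
      linarith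
  have hdom : ∀ a : R3, Integrable (fun x => 1 + g (x - a)) (volume.restrict unitCube) := fun a =>
    (integrable_const 1).add (hgi.comp_sub_right a).integrableOn
  refine ⟨volume.real unitCube + ∫ x, g x, ?_, fun a => ⟨?_, ?_⟩⟩
  · exact add_nonneg measureReal_nonneg (integral_nonneg hg0)
  · refine (hdom a).mono' (Measurable.aestronglyMeasurable (by fun_prop))
      (Filter.Eventually.of_forall fun x => ?_)
    rw [Real.norm_of_nonneg (by positivity)]
    exact hle _
  · calc ∫ x in unitCube, ‖x - a‖⁻¹ ≤ ∫ x in unitCube, (1 + g (x - a)) :=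
          integral_mono_of_nonneg (Filter.Eventually.of_forall fun x => by positivity) (hdom a)
            (Filter.Eventually.of_forall fun x => hle _)
      _ = volume.real unitCube + ∫ x in unitCube, g (x - a) := by
          rw [integral_add (integrable_const 1) (hgi.comp_sub_right a).integrableOn]
          simp
      _ ≤ volume.real unitCube + ∫ x, g (x - a) := by
          have := setIntegral_le_integral (s := unitCube) (hgi.comp_sub_right a)
            (Filter.Eventually.of_forall fun x => hg0 _)
          linarith
      _ = _ := by rw [integral_sub_right_eq_self g a]

/-! ### Convergence and decay of the interaction series -/

/-- The double series with summands of the size of `interactionTerm` converges and decays. -/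
theorem tsum_bound_of_norm_eq {z : ℂ} {ω : Z3 → ℝ} {C γ : ℝ} (hC : 0 < C) (hγ : 0 < γ)
    (hγb : γ ≤ (principalSqrt z).im / 4)
    (hΓ : ∀ i j : activeSites ω,
      ‖gammaInvEntry z ω i j‖ ≤ C * Real.exp (-γ * ‖pt i - pt j‖))
    {x y : R3} {a b : ℝ} (ha : 0 < a) (hb : 0 < b) (hax : ∀ i, a ≤ ‖x - pt i‖)
    (hby : ∀ j, b ≤ ‖y - pt j‖) {t : activeSites ω × activeSites ω → ℂ}
    (ht : ∀ p, ‖t p‖ = ‖interactionTerm z ω x y p‖) :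
    Summable t ∧ ‖∑' p, t p‖ ≤
      C * (Real.exp γ * latticeSum γ) ^ 2 / (a * b) * Real.exp (-γ * ‖x - y‖) := by
  set k := (principalSqrt z).im with hk
  set f : activeSites ω → ℝ := fun i => Real.exp (-γ * ‖x - pt i‖) with hf
  set g : activeSites ω → ℝ := fun j => Real.exp (-γ * ‖y - pt j‖) with hg
  have hpi : (1 : ℝ) ≤ 4 * Real.pi := by linarith [Real.pi_gt_three]
  -- The free factors decay at least at rate 2γ: one γ enters the triangle inequality that produces
  -- exp(-γ‖x - y‖), the other makes the sums over sites converge.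
  have hG : ∀ (v : R3) (c : ℝ) (i : Z3), 0 < c → c ≤ ‖v - pt i‖ →
      ‖freeGreen z v (pt i)‖ ≤ Real.exp (-(2 * γ) * ‖v - pt i‖) / c := fun v c i hc h => by
    rw [norm_freeGreen, ← hk]
    refine div_le_div₀ (Real.exp_pos _).le (Real.exp_le_exp.2 ?_) hc ?_
    · nlinarith [norm_nonneg (v - pt i)]
    · nlinarith
  obtain ⟨f1, f2⟩ := summable_sites_of_point (activeSites ω) hγ x
  obtain ⟨g1, g2⟩ := summable_sites_of_point (activeSites ω) hγ y
  have hf0 : 0 ≤ f := fun i => (Real.exp_pos _).le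
  have hg0 : 0 ≤ g := fun i => (Real.exp_pos _).le
  set A := C / (a * b) * Real.exp (-γ * ‖x - y‖) with hA
  have hle : ∀ p : activeSites ω × activeSites ω, ‖t p‖ ≤ A * (f p.1 * g p.2) := fun p => by
    obtain ⟨i, j⟩ := p
    rw [ht, interactionTerm, norm_mul, norm_mul, freeGreen_comm z (pt j) y]
    have h1 : ‖x - y‖ ≤ ‖x - pt i‖ + ‖pt i - pt j‖ + ‖y - pt j‖ := by
      rw [norm_sub_rev y]
      have e : x - y = (x - pt i) + (pt i - pt j) + (pt j - y) := by abel
      rw [e]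
      exact norm_add₃_le
    calc ‖freeGreen z x (pt i)‖ * ‖gammaInvEntry z ω i j‖ * ‖freeGreen z y (pt j)‖
        ≤ (Real.exp (-(2 * γ) * ‖x - pt i‖) / a) * (C * Real.exp (-γ * ‖pt i - pt j‖)) *
            (Real.exp (-(2 * γ) * ‖y - pt j‖) / b) := by
          gcongr
          · exact hG x a i ha (hax i)
          · exact hΓ i j
          · exact hG y b j hb (hby j)
      _ = C / (a * b) * (Real.exp (-(2 * γ) * ‖x - pt i‖) * Real.exp (-γ * ‖pt i - pt j‖) *
            Real.exp (-(2 * γ) * ‖y - pt j‖)) := by field_simp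
      _ ≤ C / (a * b) * (Real.exp (-γ * ‖x - y‖) * (f i * g j)) := by
          refine mul_le_mul_of_nonneg_left ?_ (by positivity)
          simp only [hf, hg, ← Real.exp_add]
          refine Real.exp_le_exp.2 ?_
          nlinarith
      _ = A * (f i * g j) := by rw [hA]; ring
  have hfg : Summable fun p : activeSites ω × activeSites ω => f p.1 * g p.2 :=
    f1.mul_of_nonneg g1 hf0 hg0
  have hs := hfg.mul_left A
  refine ⟨Summable.of_norm_bounded hs hle, (tsum_of_norm_bounded hs.hasSum hle).trans ?_⟩
  rw [tsum_mul_left, ← f1.tsum_mul_tsum g1 hfg]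
  calc A * ((∑' i, f i) * ∑' j, g j)
      ≤ A * ((Real.exp γ * latticeSum γ) * (Real.exp γ * latticeSum γ)) := by
        have := latticeSum_pos hγ
        refine mul_le_mul_of_nonneg_left ?_ (by positivity)
        exact mul_le_mul f2 g2 (tsum_nonneg hg0) (by positivity)
    _ = _ := by rw [hA]; ring

theorem measurable_freeGreen (z : ℂ) : Measurable fun q : R3 × R3 => freeGreen z q.1 q.2 := by
  unfold freeGreen
  fun_prop

theorem norm_freeGreen_le {z : ℂ} {γ : ℝ} (hγ : γ ≤ (principalSqrt z).im) (x y : R3) :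
    ‖freeGreen z x y‖ ≤ Real.exp (-γ * ‖x - y‖) * ‖x - y‖⁻¹ := by
  have hpi : (1 : ℝ) ≤ 4 * Real.pi := by linarith [Real.pi_gt_three]
  have hr := norm_nonneg (x - y)
  rw [norm_freeGreen, div_eq_mul_inv, mul_inv]
  refine mul_le_mul (Real.exp_le_exp.2 (by nlinarith)) ?_ (by positivity) (Real.exp_pos _).le
  exact mul_le_of_le_one_left (by positivity) (inv_le_one_of_one_le₀ hpi)

/-! ### Pointwise and integrated bounds for the full kernel -/

section Kernel

variable {z : ℂ} {ι : Type*} {K γ : ℝ} {t : R3 → R3 → ι → ℂ}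

/-- The pointwise decay of a kernel `G₀ + ∑ t` whose correction decays exponentially. -/
theorem norm_freeGreen_add_tsum_le (hγb : γ ≤ (principalSqrt z).im)
    (ht : ∀ (x y : R3) (a b : ℝ), 0 < a → 0 < b → (∀ i, a ≤ ‖x - pt i‖) →
      (∀ j, b ≤ ‖y - pt j‖) → Summable (t x y) ∧
        ‖∑' p, t x y p‖ ≤ K / (a * b) * Real.exp (-γ * ‖x - y‖))
    {x y : R3} (hx : x ∉ latticeSet) (hy : y ∉ latticeSet) (hxy : 1 ≤ ‖x - y‖) :
    ‖freeGreen z x y + ∑' p, t x y p‖ ≤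
      (1 + K) / (latticeDist x * latticeDist y) * Real.exp (-γ * ‖x - y‖) := by
  have hx0 := latticeDist_pos hx
  have hy0 := latticeDist_pos hy
  have h1 := (ht x y _ _ hx0 hy0 (latticeDist_le x) (latticeDist_le y)).2
  -- The condition ‖x - y‖ ≥ 1 removes the singularity on the diagonal, and distances to the lattice
  -- never exceed 1, so dividing by them only helps.
  have h2 : ‖freeGreen z x y‖ ≤
      1 / (latticeDist x * latticeDist y) * Real.exp (-γ * ‖x - y‖) := by
    refine (norm_freeGreen_le hγb x y).trans ?_
    rw [mul_comm]
    refine mul_le_mul_of_nonneg_right ?_ (Real.exp_pos _).le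
    refine (inv_le_one_of_one_le₀ hxy).trans ?_
    rw [le_div_iff₀ (mul_pos hx0 hy0), one_mul]
    exact mul_le_one₀ (latticeDist_le_one x) hy0.le (latticeDist_le_one y)
  refine (norm_add_le _ _).trans ((add_le_add h2 h1).trans_eq ?_)
  ring

/-- The decay of the integrals over pairs of cells of a kernel `G₀ + ∑ t` whose correction decays
exponentially. -/
theorem exists_integral_kernel_bound (hγ : 0 < γ) (hK : 0 ≤ K) :
    ∃ C : ℝ, 0 < C ∧ ∀ {z : ℂ} {ι : Type} [Countable ι] {t : R3 → R3 → ι → ℂ},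
      γ ≤ (principalSqrt z).im →
      (∀ p, Measurable fun q : R3 × R3 => t q.1 q.2 p) →
      (∀ (x y : R3) (a b : ℝ), 0 < a → 0 < b → (∀ i, a ≤ ‖x - pt i‖) →
        (∀ j, b ≤ ‖y - pt j‖) → Summable (t x y) ∧
          ‖∑' p, t x y p‖ ≤ K / (a * b) * Real.exp (-γ * ‖x - y‖)) →
      ∀ m n : Z3, IntegrableOn (fun p : R3 × R3 =>
          freeGreen z (p.1 + pt m) (p.2 + pt n) + ∑' q, t (p.1 + pt m) (p.2 + pt n) q)
          (unitCube ×ˢ unitCube) ∧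
        ∫ x in unitCube, ∫ y in unitCube,
          ‖freeGreen z (x + pt m) (y + pt n) + ∑' q, t (x + pt m) (y + pt n) q‖
            ≤ C * Real.exp (-γ * ‖pt n - pt m‖) := by
  obtain ⟨J, hJ0, hJ⟩ := exists_integral_inv_norm_bound
  set μ := volume.restrict unitCube with hμ
  set V := volume.real unitCube with hV
  have hV0 : 0 ≤ V := measureReal_nonneg
  -- The factor exp(2γ) pays for moving both points to their cell centres, as cube points have norm
  -- at most 1. J·J bounds the integral of the two lattice poles, J·V that of 1/‖x - y‖; the 1 only
  -- ensures positivity.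
  refine ⟨Real.exp (2 * γ) * (K * (J * J) + J * V + 1), by positivity,
    fun {z ι _ t} hγb hm ht m n => ?_⟩
  have hres : (volume : Measure (R3 × R3)).restrict (unitCube ×ˢ unitCube) = μ.prod μ := by
    rw [Measure.volume_eq_prod, Measure.prod_restrict]
  set E := Real.exp (2 * γ) * Real.exp (-γ * ‖pt n - pt m‖) with hE
  have hE0 : 0 < E := by positivity
  set c : R3 × R3 → ℝ := fun p => ‖p.1 + pt m - (p.2 + pt n)‖⁻¹ with hc
  have hcm : Measurable c := by fun_prop
  have hcx : ∀ x : R3, Integrable (fun y => c (x, y)) μ ∧ ∫ y, c (x, y) ∂μ ≤ J := fun x => by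
    have h := hJ (x + pt m - pt n)
    have e : ∀ y, c (x, y) = ‖y - (x + pt m - pt n)‖⁻¹ := fun y => by
      simp only [hc]
      rw [norm_sub_rev]
      congr 2
      abel
    simp_rw [e]
    exact h
  have hc0 : ∀ p, 0 ≤ c p := fun p => by positivity
  have hci : Integrable c (μ.prod μ) := by
    rw [integrable_prod_iff hcm.aestronglyMeasurable]
    refine ⟨Filter.Eventually.of_forall fun x => (hcx x).1, ?_⟩
    refine Integrable.of_bound
      (hcm.aestronglyMeasurable (μ := μ.prod μ)).norm.integral_prod_right' J
      (Filter.Eventually.of_forall fun x => ?_)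
    simp_rw [Real.norm_of_nonneg (hc0 _)]
    rw [Real.norm_of_nonneg (integral_nonneg fun y => hc0 _)]
    exact (hcx x).2
  have hcint : ∫ p, c p ∂μ.prod μ ≤ J * V := by
    rw [integral_prod _ hci]
    calc ∫ x, ∫ y, c (x, y) ∂μ ∂μ ≤ ∫ _, J ∂μ :=
          integral_mono_of_nonneg (Filter.Eventually.of_forall fun x =>
            integral_nonneg fun y => hc0 _) (integrable_const J)
            (Filter.Eventually.of_forall fun x => (hcx x).2)
      _ = J * V := by simp [hμ, hV, mul_comm]
  have hN : Integrable (fun x : R3 => ‖x‖⁻¹) μ ∧ ∫ x, ‖x‖⁻¹ ∂μ ≤ J := by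
    simpa using hJ 0
  have hNi : Integrable (fun p : R3 × R3 => ‖p.1‖⁻¹ * ‖p.2‖⁻¹) (μ.prod μ) := hN.1.mul_prod hN.1
  have hNint : ∫ p : R3 × R3, ‖p.1‖⁻¹ * ‖p.2‖⁻¹ ∂μ.prod μ ≤ J * J := by
    rw [integral_prod_mul (fun x : R3 => ‖x‖⁻¹) fun x : R3 => ‖x‖⁻¹]
    exact mul_le_mul hN.2 hN.2 (integral_nonneg fun x => by positivity) hJ0
  set H : R3 × R3 → ℝ := fun p => E * (K * (‖p.1‖⁻¹ * ‖p.2‖⁻¹) + c p) with hH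
  have hHi : Integrable H (μ.prod μ) := ((hNi.const_mul K).add hci).const_mul E
  have hHint : ∫ p, H p ∂μ.prod μ ≤ E * (K * (J * J) + J * V) := by
    simp only [hH]
    rw [integral_const_mul, integral_add (hNi.const_mul K) hci, integral_const_mul]
    gcongr
  have hmem : ∀ᵐ p ∂μ.prod μ, (p.1 ∈ unitCube ∧ p.1 ≠ 0) ∧ p.2 ∈ unitCube ∧ p.2 ≠ 0 := by
    have h1 : ∀ᵐ x ∂μ, x ∈ unitCube ∧ x ≠ 0 :=
      (ae_restrict_mem isClosed_unitCube.measurableSet).and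
        (ae_restrict_of_ae (compl_mem_ae_iff.2 (measure_singleton (0 : R3))))
    exact (Measure.quasiMeasurePreserving_fst.ae h1).and
      (Measure.quasiMeasurePreserving_snd.ae h1)
  set G : R3 × R3 → ℂ := fun p =>
    freeGreen z (p.1 + pt m) (p.2 + pt n) + ∑' q, t (p.1 + pt m) (p.2 + pt n) q with hG
  have hpt : ∀ᵐ p ∂μ.prod μ, Summable (t (p.1 + pt m) (p.2 + pt n)) ∧ ‖G p‖ ≤ H p := by
    filter_upwards [hmem] with p hp
    obtain ⟨⟨h1, h1'⟩, h2, h2'⟩ := hp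
    -- The distances to the lattice are ‖p.1‖ and ‖p.2‖, because the origin is a nearest lattice
    -- point on the cube.
    obtain ⟨hs, hb⟩ := ht (p.1 + pt m) (p.2 + pt n) ‖p.1‖ ‖p.2‖ (norm_pos_iff.2 h1')
      (norm_pos_iff.2 h2') (norm_le_norm_add_pt h1 m) (norm_le_norm_add_pt h2 n)
    refine ⟨hs, ?_⟩
    have hexp : Real.exp (-γ * ‖p.1 + pt m - (p.2 + pt n)‖) ≤ E := by
      rw [hE, ← Real.exp_add]
      refine Real.exp_le_exp.2 ?_
      have e : pt n - pt m = p.1 - p.2 - (p.1 + pt m - (p.2 + pt n)) := by abel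
      have h3 : ‖pt n - pt m‖ ≤ ‖p.1‖ + ‖p.2‖ + ‖p.1 + pt m - (p.2 + pt n)‖ := by
        rw [e]
        exact (norm_sub_le _ _).trans (add_le_add_left (norm_sub_le _ _) _)
      nlinarith [norm_le_of_mem_unitCube h1, norm_le_of_mem_unitCube h2]
    calc ‖G p‖ ≤ Real.exp (-γ * ‖p.1 + pt m - (p.2 + pt n)‖) * c p +
          K / (‖p.1‖ * ‖p.2‖) * Real.exp (-γ * ‖p.1 + pt m - (p.2 + pt n)‖) :=
          (norm_add_le _ _).trans (add_le_add (norm_freeGreen_le hγb _ _) hb)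
      _ ≤ E * c p + K / (‖p.1‖ * ‖p.2‖) * E := by
          have := hc0 p
          gcongr
      _ = H p := by
          simp only [hH]
          rw [div_eq_mul_inv, mul_inv]
          ring
  have hshift : Measurable fun p : R3 × R3 => (p.1 + pt m, p.2 + pt n) := by fun_prop
  have hGm : AEStronglyMeasurable G (μ.prod μ) := by
    refine ((measurable_freeGreen z).comp hshift).aestronglyMeasurable.add ?_
    -- The series is an almost everywhere limit of finite partial sums; countability of ι makes the
    -- filter of finite sets countably generated.
    refine aestronglyMeasurable_of_tendsto_ae (u := Filter.atTop)
      (f := fun (s : Finset ι) (p : R3 × R3) => ∑ q ∈ s, t (p.1 + pt m) (p.2 + pt n) q)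
      (fun s => Measurable.aestronglyMeasurable
        (Finset.measurable_fun_sum s fun q _ => (hm q).comp hshift)) ?_
    filter_upwards [hpt] with p hp
    exact hp.1.hasSum
  have hGi : Integrable G (μ.prod μ) := hHi.mono' hGm (hpt.mono fun p hp => hp.2)
  refine ⟨by rw [IntegrableOn, hres]; exact hGi, ?_⟩
  calc ∫ x in unitCube, ∫ y in unitCube, ‖G (x, y)‖ = ∫ p, ‖G p‖ ∂μ.prod μ :=
        (integral_prod _ hGi.norm).symm
    _ ≤ ∫ p, H p ∂μ.prod μ := integral_mono_ae hGi.norm hHi (hpt.mono fun p hp => hp.2)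
    _ ≤ E * (K * (J * J) + J * V) := hHint
    _ ≤ E * (K * (J * J) + J * V + 1) := mul_le_mul_of_nonneg_left (by linarith) hE0.le
    _ = _ := by rw [hE]; ring

end Kernel

end DeltaInteraction

/-! ### Assembly of the theorem -/

theorem theorem2p4 (z : ℂ) (hz : 0 < z.im) :
    ∃ C γ : ℝ, 0 < C ∧ 0 < γ ∧ ∀ ω : Z3 → ℝ,
      -- the Green's function is well defined
      IsGammaInverse z ω (gammaInv z ω) ∧
      (∀ x y : R3, x ∉ latticeSet → y ∉ latticeSet →
        Summable (interactionTerm z ω x y) ∧ Summable (interactionTermConj z ω x y)) ∧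
      -- the bounds, for the kernel without and with the complex conjugate
      ∀ G ∈ ({deltaGreen z ω, deltaGreenConj z ω} : Set (R3 → R3 → ℂ)),
        (∀ x y : R3, x ∉ latticeSet → y ∉ latticeSet → 1 ≤ ‖x - y‖ →
          ‖G x y‖ ≤ C / (latticeDist x * latticeDist y) * Real.exp (-γ * ‖x - y‖)) ∧
        (∀ m n : Z3,
          IntegrableOn (fun p : R3 × R3 => G (p.1 + pt m) (p.2 + pt n)) (unitCube ×ˢ unitCube) ∧
          ∫ x in unitCube, ∫ y in unitCube, ‖G (x + pt m) (y + pt n)‖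
            ≤ C * Real.exp (-γ * ‖pt n - pt m‖)) := by
  obtain ⟨C₀, γ, hC₀, hγ, hγb, h⟩ := exists_gammaInvEntry_bound hz
  have him := (principalSqrt_re_im_pos hz).2
  have hγb' : γ ≤ (principalSqrt z).im := hγb.trans (by linarith)
  set K := C₀ * (Real.exp γ * latticeSum γ) ^ 2 with hK
  have hK0 : 0 ≤ K := by positivity
  -- The constant is fixed before ω is introduced and serves every kernel with the same K and γ.
  obtain ⟨C₁, hC₁, hint⟩ := exists_integral_kernel_bound hγ hK0
  refine ⟨1 + K + C₁, γ, by positivity, hγ, fun ω => ?_⟩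
  obtain ⟨hinv, hent⟩ := h ω
  -- Only the moduli of the terms enter, so the conjugated series is covered with the same
  -- constants.
  have key : ∀ t : R3 → R3 → activeSites ω × activeSites ω → ℂ,
      (∀ x y p, ‖t x y p‖ = ‖interactionTerm z ω x y p‖) →
      ∀ (x y : R3) (a b : ℝ), 0 < a → 0 < b → (∀ i, a ≤ ‖x - pt i‖) →
      (∀ j, b ≤ ‖y - pt j‖) → Summable (t x y) ∧
        ‖∑' p, t x y p‖ ≤ K / (a * b) * Real.exp (-γ * ‖x - y‖) :=
    fun t ht x y a b ha hb hax hby =>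
      tsum_bound_of_norm_eq hC₀ hγ hγb hent ha hb hax hby (ht x y)
  have hconj : ∀ x y p, ‖interactionTermConj z ω x y p‖ = ‖interactionTerm z ω x y p‖ :=
    fun x y p => by
      rw [interactionTermConj, interactionTerm, norm_mul, norm_mul, norm_mul, norm_mul,
        RCLike.norm_conj]
  have main : ∀ t : R3 → R3 → activeSites ω × activeSites ω → ℂ,
      (∀ x y p, ‖t x y p‖ = ‖interactionTerm z ω x y p‖) →
      (∀ p, Measurable fun q : R3 × R3 => t q.1 q.2 p) →
      ∀ G : R3 → R3 → ℂ, (∀ x y, G x y = freeGreen z x y + ∑' p, t x y p) →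
        (∀ x y : R3, x ∉ latticeSet → y ∉ latticeSet → 1 ≤ ‖x - y‖ →
          ‖G x y‖ ≤ (1 + K + C₁) / (latticeDist x * latticeDist y) *
            Real.exp (-γ * ‖x - y‖)) ∧
        (∀ m n : Z3,
          IntegrableOn (fun p : R3 × R3 => G (p.1 + pt m) (p.2 + pt n)) (unitCube ×ˢ unitCube) ∧
          ∫ x in unitCube, ∫ y in unitCube, ‖G (x + pt m) (y + pt n)‖
            ≤ (1 + K + C₁) * Real.exp (-γ * ‖pt n - pt m‖)) := by
    intro t ht hm G hG
    simp_rw [hG]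
    refine ⟨fun x y hx hy hxy => ?_, fun m n => ?_⟩
    · refine (norm_freeGreen_add_tsum_le hγb' (key t ht) hx hy hxy).trans ?_
      exact mul_le_mul_of_nonneg_right (div_le_div_of_nonneg_right (by linarith)
        (mul_pos (latticeDist_pos hx) (latticeDist_pos hy)).le) (Real.exp_pos _).le
    · obtain ⟨h1, h2⟩ := hint hγb' hm (key t ht) m n
      exact ⟨h1, h2.trans (mul_le_mul_of_nonneg_right (by linarith) (Real.exp_pos _).le)⟩
  refine ⟨hinv, fun x y hx hy => ⟨?_, ?_⟩, ?_⟩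
  · exact (key (interactionTerm z ω) (fun _ _ _ => rfl) x y _ _ (latticeDist_pos hx) (latticeDist_pos hy)
      (latticeDist_le x) (latticeDist_le y)).1
  · exact (key (interactionTermConj z ω) hconj x y _ _ (latticeDist_pos hx) (latticeDist_pos hy)
      (latticeDist_le x) (latticeDist_le y)).1
  · rintro G (rfl | rfl)
    · refine main (interactionTerm z ω) (fun _ _ _ => rfl) (fun p => ?_) _
        fun x y => by rw [deltaGreen]
      unfold interactionTerm freeGreen
      fun_prop
    · refine main (interactionTermConj z ω) hconj (fun p => ?_) _
        fun x y => by rw [deltaGreenConj]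
      unfold interactionTermConj freeGreen
      have := Complex.continuous_conj.measurable
      fun_prop
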